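/- Let $\mathcal A$ be a finite alphabet with $|\mathcal A|\ge 2$ and let $(p_\alpha)_{\alpha\in\mathcal A}$ be a probability vector with every $p_\alpha>0$. Let $H=-\sum_\alpha p_\alpha\ln p_\alpha$, and let $d_{\mathcal A}$ be the largest $d>0$ such that $\ln p_\alpha\in d\mathbb Z$ for all $\alpha\in\mathcal A$, with $d_{\mathcal A}:=0$ if there is no such $d$. Let $\Xi^{(1)},\Xi^{(2)},\dots$ be infinite random strings whose letters are all independent with distribution $(p_\alpha)$ and, for $\lambda>0$, let $N_\lambda\sim\mathrm{Po}(\lambda)$ be independent of the strings. Let $T_\lambda$ be the trie constructed from $\Xi^{(1)},\dots,\Xi^{(N_\lambda)}$: its nodes are the finite strings $w$ that are a prefix of at least two of these strings, and those $w$ that are a prefix of exactly one of them and are either the empty string (the root) or have a parent that is a prefix of at least two of them. (The parent of a nonempty finite string is obtained by deleting its last letter.) Let $|T|_{\mathrm i}$ be the number of internal nodes of a tree $T$, i.e. of nodes that have a child in $T$; let $\varphi(T)$ be $1$ if the root is an internal node of $T$ and $0$ otherwise; let $\chi=\varphi(\bullet)$, where $\bullet$ is the tree consisting of the root only; and let $f_{\mathrm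 E}(\lambda)=\mathbb E\,\varphi(T_\lambda)-\chi\lambda e^{-\lambda}$. Assume that $d_{\mathcal A}=0$. Then: 1. For every $\lambda>0$, $T_\lambda$ is almost surely finite and $\mathbb E|T_\lambda|_{\mathrm i}<\infty$. 2. $\chi=0$ and $\int_0^\infty f_{\mathrm E}(x)\,x^{-2}\,dx=1$, with absolute convergence. 3. Define $R$ on $(0,\infty)$ by $$\frac{\mathbb E|T_\lambda|_{\mathrm i}}{\lambda}=\frac1H+R(\lambda).$$ Then $R(\lambda)\to0$ as $\lambda\to\infty$. 4. There is a constant $C<\infty$ such that there are arbitrarily large $\lambda$ with $$|R(\lambda)|>\exp\left(-C(\ln\lambda)^{(|\mathcal A|-1)/(|\mathcal A|+1)}\right).$$ 5. For every $\varepsilon>0$, it is not the case that $R(\lambda)=O(\lambda^{-\varepsilon})$ as $\lambda\to\infty$. -/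

import Mathlib

open MeasureTheory ProbabilityTheory Filter Asymptotics
open scoped Topology

noncomputable section

namespace RandomTrie

/-- The entropy `H = -∑ pₐ ln pₐ` of a probability vector. -/
def entropy {A : Type*} [Fintype A] (p : A → ℝ) : ℝ :=
  -∑ a, p a * Real.log (p a)

/-- The greatest common divisor of a set `S` of real numbers: the largest `d > 0` such that
`S ⊆ d ℤ`, and `0` if there is no such `d` (the supremum of the empty set of reals is `0`).
It is used for sets that contain a nonzero element; the supremum is then attained
as soon as some such `d` exists. -/
def realGcd (S : Set ℝ) : ℝ :=
  sSup {d : ℝ | 0 < d ∧ ∀ x ∈ S, ∃ k : ℤ, x = k * d}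

/-- `d_A`, the greatest common divisor of the numbers `-ln pₐ`. -/
def period {A : Type*} (p : A → ℝ) : ℝ :=
  realGcd (Set.range fun a => -Real.log (p a))

/-- The finite string `v` is a prefix of the infinite string `x`. -/
def IsPrefixOf {A : Type*} (v : List A) (x : ℕ → A) : Prop :=
  ∀ (i : ℕ) (hi : i < v.length), v[i] = x i

/-- The number of strings among the first `n` strings `x 0, …, x (n-1)` that have prefix `v`. -/
def prefixCount {A : Type*} (x : ℕ → ℕ → A) (n : ℕ) (v : List A) : ℕ :=
  Set.ncard {k : ℕ | k < n ∧ IsPrefixOf v (x k)}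

/-- The trie generated by the `n` strings `x 0, …, x (n-1)`, as a set of nodes of the infinite
tree of all finite strings. A node belongs to it if at least two strings pass through it, or if
exactly one string does and the node is the root or at least two strings pass through its parent.
(For `n = 0` this is the empty tree.) -/
def trie {A : Type*} (x : ℕ → ℕ → A) (n : ℕ) : Set (List A) :=
  {v | 2 ≤ prefixCount x n v ∨
    (prefixCount x n v = 1 ∧ (v = [] ∨ 2 ≤ prefixCount x n v.dropLast))}

/-- The internal nodes of a tree: the nodes that have a child in the tree. -/
def internalNodes {A : Type*} (T : Set (List A)) : Set (List A) :=
  {v | v ∈ T ∧ ∃ a : A, v ++ [a] ∈ T}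

/-- The size `|T|ᵢ` of a (finite) tree: its number of internal nodes. -/
def size {A : Type*} (T : Set (List A)) : ℕ := (internalNodes T).ncard

open Classical in
/-- The toll function of the size: the indicator that the root is an internal node. -/
def sizeToll {A : Type*} (T : Set (List A)) : ℝ :=
  if ([] : List A) ∈ internalNodes T then 1 else 0

/-- The tree `•` that consists of the root only. -/
def rootTree (A : Type*) : Set (List A) := {[]}

/-- `χ`, the value of the toll function of the size at the tree `•`. -/
def chi (A : Type*) : ℝ := sizeToll (rootTree A)

/-- The trie `T_N` generated by the first `N` of the random strings
`Ξ⁽ᵏ⁾ = ξ k 0, ξ k 1, ξ k 2, …`, where `N` is random. -/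
def randomTrie {A Ω : Type*} (ξ : ℕ → ℕ → Ω → A) (N : Ω → ℕ) (ω : Ω) : Set (List A) :=
  trie (fun k i => ξ k i ω) (N ω)

/-- The function `f_E(t) = E φ(T_t) - χ t e^{-t}`, with `φ` the toll function of the size. -/
def tollMean {A Ω : Type*} [MeasurableSpace Ω] (μ : Measure Ω) (ξ : ℕ → ℕ → Ω → A)
    (N : ℝ → Ω → ℕ) (t : ℝ) : ℝ :=
  (∫ ω, sizeToll (randomTrie ξ (N t) ω) ∂μ) - chi A * t * Real.exp (-t)

end RandomTrie

end

/-!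
By Poisson thinning, the mean size of the trie is `S(t) = ∑_v ψ(t P(v))`, where `v` runs over the
finite strings and `ψ(x) = 1 - (1 + x) e^{-x}`; hence `S(t) = ψ(t) + ∑_a S(p_a t)`. On the
logarithmic scale this is a renewal equation for `S(t) / t`. Where `S(t) / t` is close to its upper
limit, so are the `S(p_a t) / (p_a t)`; as the steps `-ln p_a` generate a dense group when
`d_A = 0`, `S(t) / t` is then close to the upper limit on logarithmic intervals of any given length.
Integrating the functional equation gives
`∑_a p_a ∫_{p_a x}^x S(t) t⁻² dt → ∫_0^∞ ψ(t) t⁻² dt = 1`,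
so the upper limit is `1 / H`, and likewise the lower limit.

For the lower bound, let `s` be a complex root of `∑_a p_a^s = 1`. The functional equation gives
`∑_a p_a^s ∫_{p_a x}^x t^{-s-1} (S(t) - t/H) dt = ∫_0^x t^{-s-1} ψ(t) dt → Γ(2 - s) / s`,
and the limit has absolute value at least `e^{-4 Im s}`. Dirichlet's theorem on simultaneous
approximation yields such roots with `Im s` arbitrarily large and
`|1 - Re s| ≤ C (Im s)^{-2/(n-1)}`, `n = |A|`, so that for `ln x` of order `(Im s)^{1 + 2/(n-1)}`
the remainder cannot be smaller than `exp(-C Im s)`.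
-/

namespace RandomTrie

/-- The probability `ψ(x)` that a Poisson variable of mean `x` is at least two. -/
noncomputable def poissonTail (x : ℝ) : ℝ := 1 - (1 + x) * Real.exp (-x)

lemma hasDerivAt_poissonTail (x : ℝ) : HasDerivAt poissonTail (x * Real.exp (-x)) x := by
  have h_exp : HasDerivAt (fun x : ℝ => Real.exp (-x)) (-Real.exp (-x)) x := by
    simpa using (hasDerivAt_neg x).exp
  refine ((((hasDerivAt_id x).const_add 1).mul h_exp).const_sub 1).congr_deriv ?_
  simp only [id]
  ring

lemma continuous_poissonTail : Continuous poissonTail := by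
  unfold poissonTail
  fun_prop

lemma poissonTail_zero : poissonTail 0 = 0 := by simp [poissonTail]

lemma poissonTail_monotoneOn : MonotoneOn poissonTail (Set.Ici 0) := by
  refine monotoneOn_of_deriv_nonneg (convex_Ici 0) continuous_poissonTail.continuousOn
    (fun x _ => (hasDerivAt_poissonTail x).differentiableAt.differentiableWithinAt) fun x hx => ?_
  rw [(hasDerivAt_poissonTail x).deriv]
  exact mul_nonneg (interior_subset hx) (Real.exp_pos _).le

lemma poissonTail_nonneg {x : ℝ} (hx : 0 ≤ x) : 0 ≤ poissonTail x := by
  simpa only [poissonTail_zero] using poissonTail_monotoneOn Set.self_mem_Ici hx hx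

lemma poissonTail_le_one {x : ℝ} (hx : 0 ≤ x) : poissonTail x ≤ 1 :=
  sub_le_self _ (by positivity)

lemma poissonTail_le_sq {x : ℝ} (hx : 0 ≤ x) : poissonTail x ≤ x ^ 2 := by
  unfold poissonTail
  nlinarith [Real.add_one_le_exp (-x)]

lemma poissonTail_eq_integral (x : ℝ) :
    poissonTail x = x ^ 2 * ∫ u in (0 : ℝ)..1, u * Real.exp (-(u * x)) := by
  have h_deriv (u : ℝ) : HasDerivAt (fun u => poissonTail (u * x))
      (x ^ 2 * (u * Real.exp (-(u * x)))) u := by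
    refine ((hasDerivAt_poissonTail (u * x)).comp u
      ((hasDerivAt_id u).mul_const x)).congr_deriv ?_
    ring
  rw [← intervalIntegral.integral_const_mul, intervalIntegral.integral_eq_sub_of_hasDerivAt
    (fun u _ => h_deriv u) (Continuous.intervalIntegrable (by fun_prop) 0 1)]
  simp only [one_mul, zero_mul, poissonTail_zero, sub_zero]

lemma poissonTail_mul_le {c x : ℝ} (hc : 1 ≤ c) (hx : 0 ≤ x) :
    poissonTail (c * x) ≤ c ^ 2 * poissonTail x := by
  rw [poissonTail_eq_integral, poissonTail_eq_integral x, mul_pow, mul_assoc]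
  gcongr c ^ 2 * (x ^ 2 * ?_)
  refine intervalIntegral.integral_mono_on zero_le_one
    (Continuous.intervalIntegrable (by fun_prop) 0 1)
    (Continuous.intervalIntegrable (by fun_prop) 0 1) fun u hu => ?_
  have := hu.1
  gcongr u * Real.exp (-(u * ?_))
  exact le_mul_of_one_le_left hx hc

lemma norm_cpow_mul_poissonTail_le_rpow {s : ℂ} {t : ℝ} (ht : 0 < t) :
    ‖(t : ℂ) ^ s * poissonTail t‖ ≤ t ^ s.re := by
  rw [norm_mul, Complex.norm_cpow_eq_rpow_re_of_pos ht, Complex.norm_real,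
    Real.norm_of_nonneg (poissonTail_nonneg ht.le)]
  exact mul_le_of_le_one_right (by positivity) (poissonTail_le_one ht.le)

lemma norm_cpow_mul_poissonTail_le_rpow_add_two {s : ℂ} {t : ℝ} (ht : 0 < t) :
    ‖(t : ℂ) ^ s * poissonTail t‖ ≤ t ^ (s.re + 2) := by
  rw [norm_mul, Complex.norm_cpow_eq_rpow_re_of_pos ht, Complex.norm_real,
    Real.norm_of_nonneg (poissonTail_nonneg ht.le), Real.rpow_add ht, Real.rpow_two]
  gcongr
  exact poissonTail_le_sq ht.le

lemma mellinConvergent_poissonTail {s : ℂ} (hs₂ : -2 < s.re) (hs₀ : s.re < 0) :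
    MellinConvergent (fun t : ℝ => (poissonTail t : ℂ)) s := by
  refine mellinConvergent_of_isBigO_rpow (a := 0) (b := -2)
    ((Complex.continuous_ofReal.comp continuous_poissonTail).continuousOn.locallyIntegrableOn
      measurableSet_Ioi) ?_ hs₀ ?_ hs₂
  · refine IsBigO.of_bound 1 ?_
    filter_upwards [eventually_ge_atTop 0] with t ht
    simpa [abs_of_nonneg (poissonTail_nonneg ht)] using poissonTail_le_one ht
  · refine IsBigO.of_bound 1 ?_
    filter_upwards [self_mem_nhdsWithin] with t (ht : 0 < t)
    simpa [abs_of_nonneg (poissonTail_nonneg ht.le)] using poissonTail_le_sq ht.le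

lemma tendsto_cpow_mul_poissonTail_nhdsGT_zero {s : ℂ} (hs : -2 < s.re) :
    Tendsto (fun t : ℝ => (t : ℂ) ^ s * poissonTail t) (𝓝[>] 0) (𝓝 0) := by
  refine squeeze_zero_norm' (a := fun t => t ^ (s.re + 2)) ?_ ?_
  · filter_upwards [self_mem_nhdsWithin] with t ht
      using norm_cpow_mul_poissonTail_le_rpow_add_two ht
  · have h := (Real.continuousAt_rpow_const 0 (s.re + 2) (Or.inr (by linarith))).tendsto
    rw [Real.zero_rpow (by linarith)] at h
    exact h.mono_left nhdsWithin_le_nhds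

lemma tendsto_cpow_mul_poissonTail_atTop {s : ℂ} (hs : s.re < 0) :
    Tendsto (fun t : ℝ => (t : ℂ) ^ s * poissonTail t) atTop (𝓝 0) := by
  refine squeeze_zero_norm' (a := fun t => t ^ s.re) ?_ ?_
  · filter_upwards [eventually_gt_atTop 0] with t ht using norm_cpow_mul_poissonTail_le_rpow ht
  · simpa using tendsto_rpow_neg_atTop (neg_pos.2 hs)

lemma hasMellin_poissonTail {s : ℂ} (hs₂ : -2 < s.re) (hs₀ : s.re < 0) :
    HasMellin (fun t : ℝ => (poissonTail t : ℂ)) s (-(Complex.Gamma (s + 2) / s)) := by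
  have hs : s ≠ 0 := by rintro rfl; simp at hs₀
  have h_conv := mellinConvergent_poissonTail hs₂ hs₀
  have h_re : 0 < (s + 2).re := by simp; linarith
  have h_deriv_mul {t : ℝ} (ht : 0 < t) :
      (t : ℂ) ^ s / s * ((t * Real.exp (-t) : ℝ) : ℂ) =
        (Real.exp (-t) * (t : ℂ) ^ (s + 2 - 1)) / s := by
    rw [show s + 2 - 1 = s + 1 by ring,
      Complex.cpow_add _ _ (Complex.ofReal_ne_zero.2 ht.ne'), Complex.cpow_one]
    push_cast
    ring
  have h_tendsto {l : Filter ℝ} (h : Tendsto (fun t : ℝ => (t : ℂ) ^ s * poissonTail t) l (𝓝 0)) :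
      Tendsto ((fun t : ℝ => (t : ℂ) ^ s / s) * fun t : ℝ => (poissonTail t : ℂ)) l (𝓝 0) := by
    rw [← zero_div s]
    exact (h.div_const s).congr fun t => by simp only [Pi.mul_apply]; ring
  have h_parts := integral_Ioi_mul_deriv_eq_deriv_mul (a := (0 : ℝ)) (a' := (0 : ℂ)) (b' := 0)
    (u := fun t : ℝ => (t : ℂ) ^ s / s) (u' := fun t : ℝ => (t : ℂ) ^ (s - 1))
    (v := fun t : ℝ => (poissonTail t : ℂ)) (v' := fun t : ℝ => ((t * Real.exp (-t) : ℝ) : ℂ))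
    (fun t (ht : 0 < t) => by
      simpa using hasDerivAt_ofReal_cpow_const' (r := s - 1) ht.ne' (by simpa using hs))
    (fun t _ => (hasDerivAt_poissonTail t).ofReal_comp)
    (IntegrableOn.congr_fun ((Complex.GammaIntegral_convergent h_re).div_const s)
      (fun t ht => (h_deriv_mul ht).symm) measurableSet_Ioi) h_conv
    (h_tendsto (tendsto_cpow_mul_poissonTail_nhdsGT_zero hs₂))
    (h_tendsto (tendsto_cpow_mul_poissonTail_atTop hs₀))
  rw [setIntegral_congr_fun measurableSet_Ioi fun t ht => h_deriv_mul ht, integral_div,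
    ← Complex.GammaIntegral, ← Complex.Gamma_eq_integral h_re, sub_zero, zero_sub] at h_parts
  exact ⟨h_conv, by rw [h_parts, neg_neg]; rfl⟩

lemma norm_Gamma_le {z : ℂ} (hz : 0 < z.re) : ‖Complex.Gamma z‖ ≤ Real.Gamma z.re := by
  rw [Complex.Gamma_eq_integral hz, Real.Gamma_eq_integral hz, Complex.GammaIntegral]
  refine (norm_integral_le_integral_norm _).trans_eq ?_
  refine setIntegral_congr_fun measurableSet_Ioi fun t (ht : 0 < t) => ?_
  simp [Complex.norm_cpow_eq_rpow_re_of_pos ht, Complex.norm_exp]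

lemma norm_sin_le (z : ℂ) : ‖Complex.sin z‖ ≤ Real.exp |z.im| := by
  have h_left : ‖Complex.exp (-z * Complex.I)‖ ≤ Real.exp |z.im| := by
    rw [Complex.norm_exp]; simpa using le_abs_self z.im
  have h_right : ‖Complex.exp (z * Complex.I)‖ ≤ Real.exp |z.im| := by
    rw [Complex.norm_exp]; simpa using neg_le_abs z.im
  rw [Complex.sin]
  simp only [norm_div, norm_mul, Complex.norm_I, mul_one, Complex.norm_ofNat]
  linarith [norm_sub_le (Complex.exp (-z * Complex.I)) (Complex.exp (z * Complex.I))]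

lemma norm_Gamma_le_two {z : ℂ} (h₁ : 1 ≤ z.re) (h₃ : z.re ≤ 3) : ‖Complex.Gamma z‖ ≤ 2 := by
  have h_three : Real.Gamma 3 = 2 := by
    rw [show (3 : ℝ) = ((2 : ℕ) : ℝ) + 1 by norm_num, Real.Gamma_nat_eq_factorial]; norm_num
  have h_max := Real.convexOn_Gamma.le_max_of_mem_Icc (x := 1) (y := 3) (z := z.re)
    (by simp) (by simp) ⟨h₁, h₃⟩
  rw [Real.Gamma_one, h_three] at h_max
  exact (norm_Gamma_le (by linarith)).trans (h_max.trans (by norm_num))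

lemma Gamma_two_sub_div_mul_Gamma_mul_sin {s : ℂ} (hs : s.im ≠ 0) :
    Complex.Gamma (2 - s) / s * (Complex.Gamma (s + 1) * Complex.sin (Real.pi * s)) =
      (1 - s) * Real.pi := by
  have hs₀ : s ≠ 0 := by rintro rfl; simp at hs
  have hs₁ : 1 - s ≠ 0 := fun h => hs (by simpa using congrArg Complex.im h)
  have h_sin : Complex.sin (Real.pi * s) ≠ 0 := by
    rw [Ne, Complex.sin_eq_zero_iff]
    rintro ⟨k, hk⟩
    have := congrArg Complex.im hk
    simp [hs, Real.pi_ne_zero] at this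
  have h_reflection := Complex.Gamma_mul_Gamma_one_sub s
  rw [eq_div_iff h_sin] at h_reflection
  rw [show (2 : ℂ) - s = 1 - s + 1 by ring, Complex.Gamma_add_one _ hs₁,
    Complex.Gamma_add_one _ hs₀]
  rw [div_mul_eq_mul_div, div_eq_iff hs₀]
  linear_combination (1 - s) * s * h_reflection

lemma exp_neg_le_norm_Gamma_two_sub_div {s : ℂ} (hs₀ : 0 ≤ s.re) (hs₂ : s.re ≤ 2)
    (him : 1 ≤ s.im) : Real.exp (-(4 * s.im)) ≤ ‖Complex.Gamma (2 - s) / s‖ := by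
  have h_one_sub : 1 ≤ ‖1 - s‖ := by
    calc 1 ≤ |(1 - s).im| := by simpa using him.trans (le_abs_self _)
      _ ≤ ‖1 - s‖ := Complex.abs_im_le_norm _
  have h_Gamma : ‖Complex.Gamma (s + 1)‖ ≤ 2 :=
    norm_Gamma_le_two (by simpa using hs₀) (by simp; linarith)
  have h_sin : ‖Complex.sin (Real.pi * s)‖ ≤ Real.exp (4 * s.im) := by
    refine (norm_sin_le _).trans (Real.exp_le_exp.2 ?_)
    rw [Complex.im_ofReal_mul, abs_of_nonneg (by positivity)]
    gcongr
    exact Real.pi_le_four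
  have h_two_le : 2 ≤ 2 * (‖Complex.Gamma (2 - s) / s‖ * Real.exp (4 * s.im)) := by
    calc 2 ≤ ‖1 - s‖ * Real.pi := by nlinarith [Real.pi_gt_three]
      _ = ‖(1 - s) * Real.pi‖ := by rw [norm_mul, Complex.norm_of_nonneg Real.pi_pos.le]
      _ = ‖Complex.Gamma (2 - s) / s‖ *
          (‖Complex.Gamma (s + 1)‖ * ‖Complex.sin (Real.pi * s)‖) := by
        rw [← Gamma_two_sub_div_mul_Gamma_mul_sin (by linarith), norm_mul, norm_mul]
      _ ≤ ‖Complex.Gamma (2 - s) / s‖ * (2 * Real.exp (4 * s.im)) := by gcongr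
      _ = _ := by ring
  rw [Real.exp_neg, inv_le_iff_one_le_mul₀ (Real.exp_pos _)]
  linarith

lemma norm_Gamma_sub_integral_poissonTail_le {s : ℂ} (hs₁ : 1 / 2 ≤ s.re) (hs₂ : s.re < 2) {x : ℝ}
    (hx : 1 ≤ x) :
    ‖Complex.Gamma (2 - s) / s - ∫ t in (0 : ℝ)..x, (t : ℂ) ^ (-s - 1) * poissonTail t‖
      ≤ 2 * x ^ (-(1 / 2) : ℝ) := by
  have hx₀ : 0 < x := by linarith
  obtain ⟨h_int, h_value⟩ := hasMellin_poissonTail (s := -s) (by simpa using hs₂)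
    (by simp; linarith)
  have h_tail (t : ℝ) (ht : t ∈ Set.Ioi x) :
      ‖(t : ℂ) ^ (-s - 1) * poissonTail t‖ ≤ t ^ (-(3 / 2) : ℝ) := by
    have ht₁ : 1 ≤ t := hx.trans (le_of_lt ht)
    refine (norm_cpow_mul_poissonTail_le_rpow (by linarith)).trans
      (Real.rpow_le_rpow_of_exponent_le ht₁ ?_)
    simp
    linarith
  have h_eq : Complex.Gamma (2 - s) / s =
      ∫ t in Set.Ioi (0 : ℝ), (t : ℂ) ^ (-s - 1) * poissonTail t := by
    simp only [mellin, smul_eq_mul] at h_value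
    rw [h_value, div_neg, neg_neg, neg_add_eq_sub]
  simp only [MellinConvergent, smul_eq_mul] at h_int
  rw [h_eq, ← intervalIntegral.integral_interval_add_Ioi h_int
    (h_int.mono_set (Set.Ioi_subset_Ioi hx₀.le)), add_sub_cancel_left]
  refine (norm_integral_le_of_norm_le (integrableOn_Ioi_rpow_of_lt (by norm_num) hx₀)
    ((ae_restrict_iff' measurableSet_Ioi).2 (ae_of_all _ h_tail))).trans_eq ?_
  rw [integral_Ioi_rpow_of_lt (by norm_num) hx₀]
  norm_num
  ring

section Strings

variable {A : Type*}

/-- A string is empty or consists of a first letter and a string, as an equivalence. -/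
def listEquivUnitSumProd (A : Type*) : List A ≃ Unit ⊕ A × List A where
  toFun
    | [] => Sum.inl ()
    | a :: v => Sum.inr (a, v)
  invFun := Sum.elim (fun _ => []) fun x => x.1 :: x.2
  left_inv v := by cases v <;> rfl
  right_inv x := by cases x <;> rfl

lemma tsum_list_eq_nil_add_sum_cons [Fintype A] {f : List A → ℝ} (hf : Summable f) :
    ∑' v, f v = f [] + ∑ a, ∑' v, f (a :: v) := by
  rw [← (listEquivUnitSumProd A).symm.summable_iff] at hf
  have hf_cons := hf.comp_injective (Sum.inr_injective (α := Unit))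
  rw [← (listEquivUnitSumProd A).symm.tsum_eq]
  refine (Summable.tsum_sum
    (hf.comp_injective (Sum.inl_injective (β := A × List A))) hf_cons).trans ?_
  congr 1
  · simp [listEquivUnitSumProd]
  · exact hf_cons.tsum_prod.trans (tsum_fintype _)

lemma summable_prod_map [Fintype A] {q : A → ℝ} (hq : ∀ a, 0 ≤ q a) (hq_sum : ∑ a, q a < 1) :
    Summable fun v : List A => (v.map q).prod := by
  classical
  rw [← (List.equivSigmaTuple (α := A)).symm.summable_iff]
  have h_ofFn (n : ℕ) (v : Fin n → A) :
      ((List.equivSigmaTuple.symm ⟨n, v⟩).map q).prod = ∏ i, q (v i) := by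
    simp [List.equivSigmaTuple, List.map_ofFn, List.prod_ofFn]
  have h_length (n : ℕ) : ∑ v : Fin n → A, ∏ i, q (v i) = (∑ a, q a) ^ n := by
    rw [← Fintype.piFinset_univ, Finset.sum_prod_piFinset Finset.univ fun _ a => q a,
      Finset.prod_const, Finset.card_univ, Fintype.card_fin]
  refine (summable_sigma_of_nonneg fun _ => List.prod_nonneg ?_).2
    ⟨fun n => Summable.of_finite, ?_⟩
  · simp only [List.mem_map]
    rintro _ ⟨a, -, rfl⟩
    exact hq a
  · simp only [tsum_fintype, h_ofFn, h_length]
    exact summable_geometric_of_lt_one (Finset.sum_nonneg fun a _ => hq a) hq_sum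

variable {p : A → ℝ}

lemma lt_one_of_sum_eq_one [Fintype A] [Nontrivial A] (hp : ∀ a, 0 < p a) (hsum : ∑ a, p a = 1)
    (a : A) : p a < 1 := by
  obtain ⟨b, hb⟩ := exists_ne a
  rw [← hsum]
  exact Finset.single_lt_sum hb (Finset.mem_univ a) (Finset.mem_univ b) (hp b)
    fun c _ _ => (hp c).le

lemma sum_sq_lt_one [Fintype A] [Nontrivial A] (hp : ∀ a, 0 < p a) (hsum : ∑ a, p a = 1) :
    ∑ a, p a ^ 2 < 1 := by
  rw [← hsum]
  refine Finset.sum_lt_sum_of_nonempty Finset.univ_nonempty fun a _ => ?_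
  exact pow_lt_self_of_lt_one₀ (hp a) (lt_one_of_sum_eq_one hp hsum a) one_lt_two

/-- The probability that an infinite string of independent letters with distribution `p` starts
with `v`. -/
def stringProb (p : A → ℝ) (v : List A) : ℝ := (v.map p).prod

lemma stringProb_nil (p : A → ℝ) : stringProb p [] = 1 := rfl

lemma stringProb_cons (p : A → ℝ) (a : A) (v : List A) :
    stringProb p (a :: v) = p a * stringProb p v := List.prod_cons

lemma stringProb_nonneg (hp : ∀ a, 0 ≤ p a) (v : List A) : 0 ≤ stringProb p v :=
  List.prod_nonneg (by simpa using fun a _ => hp a)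

lemma summable_stringProb_sq [Fintype A] (hsq : ∑ a, p a ^ 2 < 1) :
    Summable fun v => stringProb p v ^ 2 := by
  refine (summable_prod_map (fun a => sq_nonneg (p a)) hsq).congr fun v => ?_
  exact List.prod_map_hom v p (powMonoidHom 2)

/-- The mean number `S(t)` of strings that are prefixes of at least two of a Poisson number of
random strings, as a function of the mean `t` of that number. -/
noncomputable def meanSize (p : A → ℝ) (t : ℝ) : ℝ :=
  ∑' v, poissonTail (t * stringProb p v)

lemma meanSize_nonneg (hp : ∀ a, 0 ≤ p a) {t : ℝ} (ht : 0 ≤ t) : 0 ≤ meanSize p t :=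
  tsum_nonneg fun v => poissonTail_nonneg (mul_nonneg ht (stringProb_nonneg hp v))

variable [Fintype A]

lemma summable_poissonTail (hp : ∀ a, 0 ≤ p a) (hsq : ∑ a, p a ^ 2 < 1) {t : ℝ} (ht : 0 ≤ t) :
    Summable fun v => poissonTail (t * stringProb p v) := by
  have h_arg (v : List A) : 0 ≤ t * stringProb p v := mul_nonneg ht (stringProb_nonneg hp v)
  refine .of_nonneg_of_le (fun v => poissonTail_nonneg (h_arg v))
    (fun v => poissonTail_le_sq (h_arg v)) ?_
  simp_rw [mul_pow]
  exact (summable_stringProb_sq hsq).mul_left _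

lemma meanSize_le_mul_sq (hp : ∀ a, 0 ≤ p a) (hsq : ∑ a, p a ^ 2 < 1) {t : ℝ} (ht : 0 ≤ t) :
    meanSize p t ≤ (∑' v, stringProb p v ^ 2) * t ^ 2 := by
  rw [mul_comm, ← tsum_mul_left]
  refine (summable_poissonTail hp hsq ht).tsum_le_tsum (fun v => ?_)
    ((summable_stringProb_sq hsq).mul_left _)
  rw [← mul_pow]
  exact poissonTail_le_sq (mul_nonneg ht (stringProb_nonneg hp v))

lemma meanSize_monotoneOn (hp : ∀ a, 0 ≤ p a) (hsq : ∑ a, p a ^ 2 < 1) :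
    MonotoneOn (meanSize p) (Set.Ici 0) := by
  intro t ht t' ht' htt'
  refine (summable_poissonTail hp hsq ht).tsum_le_tsum (fun v => ?_)
    (summable_poissonTail hp hsq ht')
  have hv := stringProb_nonneg hp v
  exact poissonTail_monotoneOn (mul_nonneg ht hv) (mul_nonneg ht' hv)
    (mul_le_mul_of_nonneg_right htt' hv)

lemma meanSize_mul_le (hp : ∀ a, 0 ≤ p a) (hsq : ∑ a, p a ^ 2 < 1) {c t : ℝ} (hc : 1 ≤ c)
    (ht : 0 ≤ t) :
    meanSize p (c * t) ≤ c ^ 2 * meanSize p t := by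
  rw [meanSize, meanSize, ← tsum_mul_left]
  refine (summable_poissonTail hp hsq (by positivity)).tsum_le_tsum (fun v => ?_)
    ((summable_poissonTail hp hsq ht).mul_left _)
  rw [mul_assoc]
  exact poissonTail_mul_le hc (mul_nonneg ht (stringProb_nonneg hp v))

lemma meanSize_eq_poissonTail_add_sum (hp : ∀ a, 0 ≤ p a) (hsq : ∑ a, p a ^ 2 < 1) {t : ℝ}
    (ht : 0 ≤ t) :
    meanSize p t = poissonTail t + ∑ a, meanSize p (p a * t) := by
  have h_cons (a : A) (v : List A) : t * stringProb p (a :: v) = p a * t * stringProb p v := by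
    rw [stringProb_cons]; ring
  unfold meanSize
  rw [tsum_list_eq_nil_add_sum_cons (summable_poissonTail hp hsq ht), stringProb_nil, mul_one]
  simp only [h_cons]

lemma aemeasurable_meanSize (hp : ∀ a, 0 ≤ p a) (hsq : ∑ a, p a ^ 2 < 1) :
    AEMeasurable (meanSize p) (volume.restrict (Set.Ioi 0)) :=
  aemeasurable_restrict_of_monotoneOn measurableSet_Ioi
    ((meanSize_monotoneOn hp hsq).mono Set.Ioi_subset_Ici_self)

end Strings

section FunctionalEquation

lemma cpow_mul_ofReal_mul_cpow {c t : ℝ} (hc : 0 < c) (ht : 0 ≤ t) (s : ℂ) :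
    (c : ℂ) ^ (s + 1) * ((c * t : ℝ) : ℂ) ^ (-s - 1) = (t : ℂ) ^ (-s - 1) := by
  rw [Complex.ofReal_mul, Complex.mul_cpow_ofReal_nonneg hc.le ht, ← mul_assoc,
    ← Complex.cpow_add _ _ (Complex.ofReal_ne_zero.2 hc.ne'), show s + 1 + (-s - 1) = 0 by ring,
    Complex.cpow_zero, one_mul]

lemma cpow_mul_integral_cpow_mul_eq {c x : ℝ} (hc : 0 < c) (hx : 0 ≤ x) (s : ℂ) (f : ℝ → ℂ) :
    (c : ℂ) ^ s * ∫ t in (0 : ℝ)..(c * x), (t : ℂ) ^ (-s - 1) * f t =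
      ∫ t in (0 : ℝ)..x, (t : ℂ) ^ (-s - 1) * f (c * t) := by
  have h_pow : (c : ℂ) ^ s * c = (c : ℂ) ^ (s + 1) := by
    rw [Complex.cpow_add _ _ (Complex.ofReal_ne_zero.2 hc.ne'), Complex.cpow_one]
  have h_subst := intervalIntegral.smul_integral_comp_mul_left (a := 0) (b := x)
    (fun t : ℝ => (t : ℂ) ^ (-s - 1) * f t) c
  rw [mul_zero, Complex.real_smul] at h_subst
  rw [← h_subst, ← mul_assoc, h_pow, ← intervalIntegral.integral_const_mul]
  refine intervalIntegral.integral_congr_ae (ae_of_all _ fun t ht => ?_)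
  rw [Set.uIoc_of_le hx] at ht
  rw [← mul_assoc, cpow_mul_ofReal_mul_cpow hc ht.1.le]

lemma intervalIntegrable_cpow_mul_comp_mul {c x : ℝ} (hc : 0 < c) (hx : 0 ≤ x) {s : ℂ} {f : ℝ → ℂ}
    (hf : IntervalIntegrable (fun t : ℝ => (t : ℂ) ^ (-s - 1) * f t) volume 0 (c * x)) :
    IntervalIntegrable (fun t : ℝ => (t : ℂ) ^ (-s - 1) * f (c * t)) volume 0 x := by
  have h := hf.comp_mul_left (c := c)
  rw [zero_div, mul_div_cancel_left₀ _ hc.ne'] at h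
  refine (h.const_mul ((c : ℂ) ^ (s + 1))).congr fun t ht => ?_
  rw [Set.uIoc_of_le hx] at ht
  rw [← mul_assoc, cpow_mul_ofReal_mul_cpow hc ht.1.le]

variable {A : Type*} [Fintype A] {p : A → ℝ}

lemma sum_cpow_mul_integral_eq {f k : ℝ → ℂ} {s : ℂ} (hp : ∀ a, 0 < p a)
    (hs : ∑ a, (p a : ℂ) ^ s = 1) (hfk : ∀ t, 0 < t → f t = k t + ∑ a, f (p a * t))
    (hf : ∀ y, 0 ≤ y → IntervalIntegrable (fun t : ℝ => (t : ℂ) ^ (-s - 1) * f t) volume 0 y)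
    {x : ℝ} (hx : 0 ≤ x) :
    ∑ a, (p a : ℂ) ^ s * ∫ t in (p a * x)..x, (t : ℂ) ^ (-s - 1) * f t =
      ∫ t in (0 : ℝ)..x, (t : ℂ) ^ (-s - 1) * k t := by
  have hpx (a : A) : 0 ≤ p a * x := mul_nonneg (hp a).le hx
  have h_split (a : A) : ∫ t in (p a * x)..x, (t : ℂ) ^ (-s - 1) * f t =
      (∫ t in (0 : ℝ)..x, (t : ℂ) ^ (-s - 1) * f t) -
        ∫ t in (0 : ℝ)..(p a * x), (t : ℂ) ^ (-s - 1) * f t :=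
    (intervalIntegral.integral_interval_sub_left (hf x hx) (hf _ (hpx a))).symm
  have hf_scaled (a : A) := intervalIntegrable_cpow_mul_comp_mul (hp a) hx (hf _ (hpx a))
  have hf_sum : IntervalIntegrable
      (fun t : ℝ => ∑ a, (t : ℂ) ^ (-s - 1) * f (p a * t)) volume 0 x := by
    simpa only [Finset.sum_fn] using! IntervalIntegrable.sum Finset.univ fun a _ => hf_scaled a
  simp_rw [h_split, mul_sub, Finset.sum_sub_distrib,
    cpow_mul_integral_cpow_mul_eq (hp _) hx, ← Finset.sum_mul, hs, one_mul]
  rw [← intervalIntegral.integral_finsetSum fun a _ => hf_scaled a,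
    ← intervalIntegral.integral_sub (hf x hx) hf_sum]
  refine intervalIntegral.integral_congr_ae (ae_of_all _ fun t ht => ?_)
  rw [Set.uIoc_of_le hx] at ht
  rw [← Finset.mul_sum, ← mul_sub, hfk t ht.1, add_sub_cancel_right]

lemma intervalIntegrable_cpow_mul_meanSize (hp : ∀ a, 0 ≤ p a) (hsq : ∑ a, p a ^ 2 < 1) {s : ℂ}
    (hs : s.re < 2) {x y : ℝ} (hx : 0 ≤ x) (hy : 0 ≤ y) :
    IntervalIntegrable (fun t : ℝ => (t : ℂ) ^ (-s - 1) * meanSize p t) volume x y := by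
  have h_sub : Set.uIoc x y ⊆ Set.Ioi 0 := fun t ht => (le_min hx hy).trans_lt ht.1
  have h_dom : IntervalIntegrable
      (fun t : ℝ => (∑' v, stringProb p v ^ 2) * t ^ (1 - s.re)) volume x y :=
    (intervalIntegral.intervalIntegrable_rpow' (by linarith)).const_mul _
  refine h_dom.mono_fun (AEMeasurable.aestronglyMeasurable (AEMeasurable.mul
    (Complex.measurable_ofReal.pow_const _).aemeasurable
    (Complex.measurable_ofReal.comp_aemeasurable ((aemeasurable_meanSize hp hsq).mono_measure
      (Measure.restrict_mono h_sub le_rfl))))) ?_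
  refine (ae_restrict_iff' measurableSet_uIoc).2 (ae_of_all _ fun t ht => ?_)
  have ht₀ : 0 < t := h_sub ht
  refine le_trans ?_ (le_abs_self _)
  simp only
  rw [norm_mul, Complex.norm_cpow_eq_rpow_re_of_pos ht₀, Complex.norm_real,
    Real.norm_of_nonneg (meanSize_nonneg hp ht₀.le)]
  calc t ^ (-s - 1).re * meanSize p t
      ≤ t ^ (-s - 1).re * ((∑' v, stringProb p v ^ 2) * t ^ 2) := by
        gcongr; exact meanSize_le_mul_sq hp hsq ht₀.le
    _ = (∑' v, stringProb p v ^ 2) * (t ^ (-s - 1).re * t ^ (2 : ℝ)) := by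
        rw [Real.rpow_two]; ring
    _ = (∑' v, stringProb p v ^ 2) * t ^ (1 - s.re) := by
        rw [← Real.rpow_add ht₀]; congr 2; simp; ring

lemma sum_cpow_mul_integral_meanSize_eq (hp : ∀ a, 0 < p a) (hsq : ∑ a, p a ^ 2 < 1) {s : ℂ}
    (hs_lt : s.re < 2) (hs : ∑ a, (p a : ℂ) ^ s = 1) {x : ℝ} (hx : 0 ≤ x) :
    ∑ a, (p a : ℂ) ^ s * ∫ t in (p a * x)..x, (t : ℂ) ^ (-s - 1) * meanSize p t =
      ∫ t in (0 : ℝ)..x, (t : ℂ) ^ (-s - 1) * poissonTail t := by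
  refine sum_cpow_mul_integral_eq (f := fun t => (meanSize p t : ℂ))
    (k := fun t => (poissonTail t : ℂ)) hp hs (fun t ht => ?_)
    (fun y => intervalIntegrable_cpow_mul_meanSize (fun a => (hp a).le) hsq hs_lt le_rfl) hx
  rw [meanSize_eq_poissonTail_add_sum (fun a => (hp a).le) hsq ht.le]
  push_cast
  rfl

lemma ofReal_cpow_neg_one_sub_one_mul (t y : ℝ) :
    (t : ℂ) ^ (-1 - 1 : ℂ) * y = ((y / t ^ 2 : ℝ) : ℂ) := by
  rw [show (-1 - 1 : ℂ) = -2 by norm_num, Complex.cpow_neg]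
  push_cast
  norm_cast
  rw [div_eq_inv_mul]

lemma intervalIntegrable_meanSize_div_sq (hp : ∀ a, 0 ≤ p a) (hsq : ∑ a, p a ^ 2 < 1) {x y : ℝ}
    (hx : 0 ≤ x) (hy : 0 ≤ y) :
    IntervalIntegrable (fun t => meanSize p t / t ^ 2) volume x y := by
  have h := intervalIntegrable_cpow_mul_meanSize hp hsq (s := 1) (by simp) hx hy
  simp_rw [ofReal_cpow_neg_one_sub_one_mul] at h
  exact intervalIntegrable_iff.2 (intervalIntegrable_iff.1 h).re

lemma sum_mul_integral_meanSize_div_sq (hp : ∀ a, 0 < p a) (hsq : ∑ a, p a ^ 2 < 1)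
    (hsum : ∑ a, p a = 1) {x : ℝ} (hx : 0 ≤ x) :
    ∑ a, p a * ∫ t in (p a * x)..x, meanSize p t / t ^ 2 =
      ∫ t in (0 : ℝ)..x, poissonTail t / t ^ 2 := by
  have h := sum_cpow_mul_integral_meanSize_eq hp hsq (s := 1) (by simp)
    (by simp only [Complex.cpow_one]; exact_mod_cast hsum) hx
  simp_rw [ofReal_cpow_neg_one_sub_one_mul, intervalIntegral.integral_ofReal, Complex.cpow_one] at h
  exact_mod_cast h

lemma hasMellin_poissonTail_neg_one : HasMellin (fun t : ℝ => (poissonTail t : ℂ)) (-1) 1 := by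
  have h := hasMellin_poissonTail (s := -1) (by norm_num) (by norm_num)
  norm_num at h
  exact h

lemma integrableOn_poissonTail_div_sq :
    IntegrableOn (fun t => poissonTail t / t ^ 2) (Set.Ioi 0) := by
  have h := hasMellin_poissonTail_neg_one.1
  simp_rw [MellinConvergent, smul_eq_mul, ofReal_cpow_neg_one_sub_one_mul] at h
  exact h.re

lemma integral_poissonTail_div_sq : ∫ t in Set.Ioi (0 : ℝ), poissonTail t / t ^ 2 = 1 := by
  have h := hasMellin_poissonTail_neg_one.2
  simp_rw [mellin, smul_eq_mul, ofReal_cpow_neg_one_sub_one_mul, integral_complex_ofReal] at h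
  exact_mod_cast h

lemma integral_poissonTail_div_sq_le_one {x : ℝ} (hx : 0 ≤ x) :
    ∫ t in (0 : ℝ)..x, poissonTail t / t ^ 2 ≤ 1 := by
  rw [← integral_poissonTail_div_sq, intervalIntegral.integral_of_le hx]
  refine setIntegral_mono_set integrableOn_poissonTail_div_sq ?_
    (Set.Ioc_subset_Ioi_self).eventuallyLE
  exact (ae_restrict_iff' measurableSet_Ioi).2 (ae_of_all _ fun t (ht : 0 < t) =>
    div_nonneg (poissonTail_nonneg ht.le) (sq_nonneg t))

lemma sq_mul_meanSize_le (hp : ∀ a, 0 ≤ p a) (hsq : ∑ a, p a ^ 2 < 1) {c x t : ℝ} (hc : 0 < c)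
    (hc₁ : c ≤ 1) (hx : 0 ≤ x) (hcx : c * x ≤ t) : c ^ 2 * meanSize p x ≤ meanSize p t := by
  have hcx₀ : 0 ≤ c * x := mul_nonneg hc.le hx
  have h := meanSize_mul_le hp hsq ((one_le_inv₀ hc).2 hc₁) hcx₀
  rw [inv_mul_cancel_left₀ hc.ne', inv_pow, ← div_eq_inv_mul, le_div_iff₀' (by positivity)] at h
  exact h.trans (meanSize_monotoneOn hp hsq hcx₀ (hcx₀.trans hcx) hcx)

lemma mul_meanSize_div_le_integral (hp : ∀ a, 0 ≤ p a) (hsq : ∑ a, p a ^ 2 < 1) {c x : ℝ}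
    (hc : 0 < c) (hc₁ : c ≤ 1) (hx : 0 < x) :
    c ^ 2 * (1 - c) * (meanSize p x / x) ≤ ∫ t in (c * x)..x, meanSize p t / t ^ 2 := by
  have hcx : c * x ≤ x := mul_le_of_le_one_left hx.le hc₁
  have hcx₀ : 0 < c * x := mul_pos hc hx
  calc c ^ 2 * (1 - c) * (meanSize p x / x)
      = ∫ _ in (c * x)..x, c ^ 2 * meanSize p x / x ^ 2 := by
        rw [intervalIntegral.integral_const, smul_eq_mul]; field_simp
    _ ≤ ∫ t in (c * x)..x, meanSize p t / t ^ 2 := by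
        refine intervalIntegral.integral_mono_on hcx (by simp)
          (intervalIntegrable_meanSize_div_sq hp hsq hcx₀.le hx.le) fun t ht => ?_
        have ht₀ : 0 < t := hcx₀.trans_le ht.1
        have := meanSize_nonneg hp ht₀.le
        gcongr
        · exact sq_mul_meanSize_le hp hsq hc hc₁ hx.le ht.1
        · exact ht.2

lemma exists_meanSize_le_mul [Nontrivial A] (hp : ∀ a, 0 < p a) (hsum : ∑ a, p a = 1) :
    ∃ B, ∀ t, 0 < t → meanSize p t ≤ B * t := by
  obtain ⟨a⟩ := (inferInstance : Nonempty A)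
  have hp' (b : A) : 0 ≤ p b := (hp b).le
  have hp₁ := lt_one_of_sum_eq_one hp hsum
  have hsq := sum_sq_lt_one hp hsum
  have hpa := hp a
  have hpa₁ : 0 < 1 - p a := sub_pos.2 (hp₁ a)
  refine ⟨(p a * (p a ^ 2 * (1 - p a)))⁻¹, fun x hx => ?_⟩
  have h_term_nonneg (b : A) : 0 ≤ p b * ∫ t in (p b * x)..x, meanSize p t / t ^ 2 := by
    refine mul_nonneg (hp' b) (intervalIntegral.integral_nonneg
      (mul_le_of_le_one_left hx.le (hp₁ b).le) fun t ht => div_nonneg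
        (meanSize_nonneg hp' ((mul_pos (hp b) hx).le.trans ht.1)) (sq_nonneg t))
  have h_le : p a * (p a ^ 2 * (1 - p a) * (meanSize p x / x)) ≤ 1 := by
    calc p a * (p a ^ 2 * (1 - p a) * (meanSize p x / x))
        ≤ p a * ∫ t in (p a * x)..x, meanSize p t / t ^ 2 := by
          gcongr
          exact mul_meanSize_div_le_integral hp' hsq hpa (hp₁ a).le hx
      _ ≤ ∑ b, p b * ∫ t in (p b * x)..x, meanSize p t / t ^ 2 :=
          Finset.single_le_sum (f := fun b => p b * ∫ t in (p b * x)..x, meanSize p t / t ^ 2)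
            (fun b _ => h_term_nonneg b) (Finset.mem_univ a)
      _ ≤ 1 := by
          rw [sum_mul_integral_meanSize_div_sq hp hsq hsum hx.le]
          exact integral_poissonTail_div_sq_le_one hx.le
  rwa [← mul_assoc, ← mul_div_assoc, div_le_one hx, ← le_inv_mul_iff₀ (by positivity)] at h_le

end FunctionalEquation

section Density

lemma exists_eq_sub_of_mem_addSubgroup_closure {G : Type*} [AddCommGroup G] {S : Set G} {x : G}
    (hx : x ∈ AddSubgroup.closure S) :
    ∃ y ∈ AddSubmonoid.closure S, ∃ z ∈ AddSubmonoid.closure S, x = y - z := by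
  rw [← AddSubgroup.mem_toAddSubmonoid, AddSubgroup.closure_toAddSubmonoid,
    AddSubmonoid.closure_union, AddSubmonoid.closure_neg, AddSubmonoid.mem_sup] at hx
  obtain ⟨y, hy, z, hz, rfl⟩ := hx
  exact ⟨y, hy, -z, hz, by rw [sub_neg_eq_add]⟩

lemma exists_nat_mul_add_nat_mul_near {r g x : ℝ} (hr : 0 < r) (hg : 0 < g)
    (hx : r * (r / g + 1) ≤ x) : ∃ i j : ℕ, |x - (i * r + j * (r + g))| < g := by
  have hxr : r / g + 1 ≤ x / r := by rwa [le_div_iff₀' hr]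
  have hx₀ : 0 ≤ x / r := le_trans (by positivity) hxr
  set n := ⌊x / r⌋₊
  have hn_lt : x < (n + 1) * r := (div_lt_iff₀ hr).1 (Nat.lt_floor_add_one _)
  have hn_le : n * r ≤ x := (le_div_iff₀ hr).1 (Nat.floor_le hx₀)
  have hn : r / g ≤ n := by linarith [Nat.lt_floor_add_one (x / r)]
  set j := ⌊(x - n * r) / g⌋₊
  have hj_lt : x - n * r < (j + 1) * g := (div_lt_iff₀ hg).1 (Nat.lt_floor_add_one _)
  have hj_le : j * g ≤ x - n * r :=
    (le_div_iff₀ hg).1 (Nat.floor_le (div_nonneg (by linarith) hg.le))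
  have hjn : j ≤ n := by
    have : (j : ℝ) ≤ r / g := (le_div_iff₀ hg).2 (by linarith)
    exact_mod_cast this.trans hn
  refine ⟨n - j, j, ?_⟩
  rw [Nat.cast_sub hjn, abs_lt]
  constructor <;> linarith

lemma exists_forall_ge_exists_mem_closure_near {S : Set ℝ} (hS : ∀ x ∈ S, 0 < x)
    (hS_ne : S.Nonempty) (hS_dense : Dense (AddSubgroup.closure S : Set ℝ)) {ε : ℝ} (hε : 0 < ε) :
    ∃ L : ℝ, ∀ x, L ≤ x → ∃ s ∈ AddSubmonoid.closure S, |x - s| < ε := by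
  obtain ⟨g, hgS, hg, hgε⟩ := hS_dense.exists_between hε
  obtain ⟨y, hy, z, hz, rfl⟩ := exists_eq_sub_of_mem_addSubgroup_closure hgS
  obtain ⟨x₀, hx₀⟩ := hS_ne
  have hz_nonneg : z ∈ AddSubmonoid.nonneg ℝ :=
    AddSubmonoid.closure_le.2 (fun x hx => (hS x hx).le) hz
  have hr : 0 < z + x₀ := add_pos_of_nonneg_of_pos hz_nonneg (hS x₀ hx₀)
  have hx₀_mem := AddSubmonoid.subset_closure hx₀
  refine ⟨(z + x₀) * ((z + x₀) / (y - z) + 1), fun x hx => ?_⟩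
  obtain ⟨i, j, hij⟩ := exists_nat_mul_add_nat_mul_near hr hg hx
  refine ⟨i • (z + x₀) + j • (y + x₀), add_mem (nsmul_mem (add_mem hz hx₀_mem) i)
    (nsmul_mem (add_mem hy hx₀_mem) j), ?_⟩
  rw [nsmul_eq_mul, nsmul_eq_mul, show y + x₀ = z + x₀ + (y - z) by ring]
  exact hij.trans hgε

lemma le_realGcd {S : Set ℝ} {x : ℝ} (hxS : x ∈ S) (hx : x ≠ 0) {d : ℝ} (hd : 0 < d)
    (hdS : ∀ y ∈ S, ∃ k : ℤ, y = k * d) : d ≤ realGcd S := by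
  refine le_csSup ⟨|x|, ?_⟩ ⟨hd, hdS⟩
  rintro e ⟨he, heS⟩
  obtain ⟨k, rfl⟩ := heS x hxS
  have hk : (1 : ℝ) ≤ |(k : ℝ)| := by
    exact_mod_cast Int.one_le_abs fun hk => hx (by simp [hk])
  rw [abs_mul, abs_of_pos he]
  exact le_mul_of_one_le_left he.le hk

lemma dense_closure_of_realGcd_eq_zero {S : Set ℝ} {x : ℝ} (hxS : x ∈ S) (hx : x ≠ 0)
    (hS : realGcd S = 0) : Dense (AddSubgroup.closure S : Set ℝ) := by
  refine (AddSubgroup.dense_or_cyclic _).resolve_right ?_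
  rintro ⟨d, hd⟩
  have h_mul (y : ℝ) (hy : y ∈ S) : ∃ k : ℤ, y = k * |d| := by
    have hy' : y ∈ AddSubgroup.closure {d} := hd ▸ AddSubgroup.subset_closure hy
    obtain ⟨k, rfl⟩ := AddSubgroup.mem_closure_singleton.1 hy'
    rcases abs_choice d with h | h
    · exact ⟨k, by rw [h, zsmul_eq_mul]⟩
    · exact ⟨-k, by rw [h, zsmul_eq_mul]; push_cast; ring⟩
  have hd₀ : 0 < |d| := by
    refine abs_pos.2 fun hd₀ => hx ?_
    obtain ⟨k, hk⟩ := h_mul x hxS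
    rw [hk, hd₀, abs_zero, mul_zero]
  exact (le_realGcd hxS hx hd₀ h_mul).not_gt (hS ▸ hd₀)

end Density

section Renewal

variable {A : Type*} [Fintype A] {p : A → ℝ}

lemma tendsto_of_tendsto_sum_mul {α : Type*} {F : Filter α} {g : A → α → ℝ} {β : ℝ}
    (hp : ∀ a, 0 < p a) (hsum : ∑ a, p a = 1)
    (hg_lt : ∀ a, ∀ c > β, ∀ᶠ u in F, g a u < c)
    (hg : Tendsto (fun u => ∑ a, p a * g a u) F (𝓝 β)) (a : A) : Tendsto (g a) F (𝓝 β) := by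
  classical
  refine tendsto_order.2 ⟨fun c hc => ?_, hg_lt a⟩
  obtain ⟨δ, hδ⟩ : ∃ δ, δ = p a * (β - c) / 2 := ⟨_, rfl⟩
  have hδ₀ : 0 < δ := by have := hp a; have := sub_pos.2 hc; rw [hδ]; positivity
  filter_upwards [hg.eventually (lt_mem_nhds (show β - δ < β by linarith)),
    eventually_all.2 fun b => hg_lt b (β + δ) (by linarith)] with u h_sum h_lt
  have h_rest : ∑ b ∈ Finset.univ.erase a, p b * g b u ≤ (1 - p a) * (β + δ) := by
    rw [← hsum, ← Finset.add_sum_erase _ p (Finset.mem_univ a), add_sub_cancel_left,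
      Finset.sum_mul]
    exact Finset.sum_le_sum fun b _ => mul_le_mul_of_nonneg_left (h_lt b).le (hp b).le
  rw [← Finset.add_sum_erase _ _ (Finset.mem_univ a)] at h_sum
  have := mul_pos (hp a) hδ₀
  refine lt_of_mul_lt_mul_left ?_ (hp a).le
  linarith

variable {l : A → ℝ} {f k : ℝ → ℝ} {β : ℝ} {F : Filter ℝ}

lemma tendsto_sub_const_of_le_atTop (hF : F ≤ atTop) (s : ℝ) : Tendsto (fun u => u - s) F atTop :=
  (tendsto_atTop_add_const_right atTop (-s) tendsto_id).mono_left hF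

-- Where `f` is close to its upper limit `β`, all terms of the weighted mean `∑ p a * f (u - l a)`
-- must be close to `β` as well, because none of them exceeds `β` by much.
lemma tendsto_comp_sub_of_mem_closure (hp : ∀ a, 0 < p a) (hsum : ∑ a, p a = 1)
    (hk : Tendsto k atTop (𝓝 0)) (hf : ∀ u, f u = k u + ∑ a, p a * f (u - l a))
    (hf_lt : ∀ c > β, ∀ᶠ u in atTop, f u < c) (hF : F ≤ atTop) (hfF : Tendsto f F (𝓝 β)) {s : ℝ}
    (hs : s ∈ AddSubmonoid.closure (Set.range l)) : Tendsto (fun u => f (u - s)) F (𝓝 β) := by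
  induction hs using AddSubmonoid.closure_induction_right with
  | zero => simpa only [sub_zero] using hfF
  | add_right s _ y hy ih =>
    obtain ⟨a, rfl⟩ := hy
    simp_rw [← sub_sub]
    refine tendsto_of_tendsto_sum_mul (g := fun a u => f (u - s - l a)) hp hsum
      (fun b c hc => ?_) ?_ a
    · simp_rw [sub_sub]
      exact (tendsto_sub_const_of_le_atTop hF _).eventually (hf_lt c hc)
    · have h := ih.sub (hk.comp (tendsto_sub_const_of_le_atTop hF s))
      rw [sub_zero] at h
      refine h.congr fun u => ?_
      rw [hf (u - s), Function.comp_apply, add_sub_cancel_left]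

lemma eventually_forall_mem_lt_comp_sub {D K : Set ℝ} {δ ε : ℝ}
    (hf : ∀ x y, |x - y| < δ → |f x - f y| < ε) (hε : 0 < ε)
    (hD : ∀ s ∈ D, Tendsto (fun u => f (u - s)) F (𝓝 β)) (hK : IsCompact K)
    (hKD : ∀ x ∈ K, ∃ s ∈ D, |x - s| < δ) : ∀ᶠ u in F, ∀ x ∈ K, β - 2 * ε < f (u - x) := by
  refine hK.induction_on (p := fun K => ∀ᶠ u in F, ∀ x ∈ K, β - 2 * ε < f (u - x))
    (by simp) (fun K₁ K₂ h_sub h => h.mono fun u hu x hx => hu x (h_sub hx))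
    (fun K₁ K₂ h₁ h₂ => ?_) fun x hx => ?_
  · filter_upwards [h₁, h₂] with u hu₁ hu₂ y hy
    exact hy.elim (hu₁ y) (hu₂ y)
  · obtain ⟨s, hs, hxs⟩ := hKD x hx
    refine ⟨Metric.ball s δ, mem_nhdsWithin_of_mem_nhds (Metric.isOpen_ball.mem_nhds hxs), ?_⟩
    filter_upwards [(hD s hs).eventually (lt_mem_nhds (show β - ε < β by linarith))]
      with u hu y (hy : |y - s| < δ)
    have h := (abs_lt.1 (hf (u - y) (u - s) (by rwa [sub_sub_sub_cancel_left, abs_sub_comm]))).1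
    linarith

lemma mul_sum_mul_le_sum_mul_integral {c L M u : ℝ} (hp : ∀ a, 0 ≤ p a) (hl : ∀ a, 0 ≤ l a)
    (hlM : ∀ a, l a ≤ M) (hf : Continuous f) (hcf : ∀ x ∈ Set.Icc L (L + M), c ≤ f (u - x)) :
    c * ∑ a, p a * l a ≤ ∑ a, p a * ∫ t in (u - L - l a)..(u - L), f t := by
  rw [Finset.mul_sum]
  refine Finset.sum_le_sum fun a _ => ?_
  calc c * (p a * l a) = p a * ∫ _ in (u - L - l a)..(u - L), c := by
        rw [intervalIntegral.integral_const, smul_eq_mul]; ring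
    _ ≤ p a * ∫ t in (u - L - l a)..(u - L), f t := by
        refine mul_le_mul_of_nonneg_left ?_ (hp a)
        refine intervalIntegral.integral_mono_on (by linarith [hl a]) (by simp)
          (hf.intervalIntegrable _ _) fun t ht => ?_
        simpa using hcf (u - t) ⟨by linarith [ht.2], by linarith [ht.1, hlM a]⟩

lemma sub_mul_sum_mul_le_of_tendsto [Nonempty A] {κ ε : ℝ} (hp : ∀ a, 0 < p a)
    (hsum : ∑ a, p a = 1) (hl : ∀ a, 0 < l a)
    (hl_dense : Dense (AddSubgroup.closure (Set.range l) : Set ℝ)) (hf_uc : UniformContinuous f)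
    (hk : Tendsto k atTop (𝓝 0)) (hf : ∀ u, f u = k u + ∑ a, p a * f (u - l a))
    (hκ : Tendsto (fun u => ∑ a, p a * ∫ t in (u - l a)..u, f t) atTop (𝓝 κ))
    (hf_lt : ∀ c > β, ∀ᶠ u in atTop, f u < c) [NeBot F] (hF : F ≤ atTop)
    (hfF : Tendsto f F (𝓝 β)) (hε : 0 < ε) : (β - 2 * ε) * ∑ a, p a * l a ≤ κ := by
  obtain ⟨δ, hδ, hfδ⟩ := Metric.uniformContinuous_iff.1 hf_uc ε hε
  obtain ⟨L, hL⟩ := exists_forall_ge_exists_mem_closure_near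
    (by rintro _ ⟨a, rfl⟩; exact hl a) (Set.range_nonempty l) hl_dense hδ
  obtain ⟨M, hM⟩ := Finite.bddAbove_range l
  have h_lower : ∀ᶠ u in F, ∀ x ∈ Set.Icc L (L + M), β - 2 * ε < f (u - x) :=
    eventually_forall_mem_lt_comp_sub (fun _ _ h => hfδ h) hε
      (fun _ hs => tendsto_comp_sub_of_mem_closure hp hsum hk hf hf_lt hF hfF hs)
      isCompact_Icc fun x hx => hL x hx.1
  refine ge_of_tendsto (hκ.comp (tendsto_sub_const_of_le_atTop hF L)) ?_
  filter_upwards [h_lower] with u hu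
  exact mul_sum_mul_le_sum_mul_integral (fun a => (hp a).le) (fun a => (hl a).le)
    (fun a => hM ⟨a, rfl⟩) hf_uc.continuous fun x hx => (hu x hx).le

lemma eventually_lt_of_renewal [Nonempty A] {B κ c : ℝ} (hp : ∀ a, 0 < p a)
    (hsum : ∑ a, p a = 1) (hl : ∀ a, 0 < l a)
    (hl_dense : Dense (AddSubgroup.closure (Set.range l) : Set ℝ)) (hB : ∀ u, |f u| ≤ B)
    (hf_uc : UniformContinuous f) (hk : Tendsto k atTop (𝓝 0))
    (hf : ∀ u, f u = k u + ∑ a, p a * f (u - l a))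
    (hκ : Tendsto (fun u => ∑ a, p a * ∫ t in (u - l a)..u, f t) atTop (𝓝 κ))
    (hc : κ / ∑ a, p a * l a < c) : ∀ᶠ u in atTop, f u < c := by
  have h_above : IsBoundedUnder (· ≤ ·) atTop f :=
    isBoundedUnder_of ⟨B, fun u => (abs_le.1 (hB u)).2⟩
  have h_below : IsBoundedUnder (· ≥ ·) atTop f :=
    isBoundedUnder_of ⟨-B, fun u => (abs_le.1 (hB u)).1⟩
  have hf_lt (d : ℝ) (hd : limsup f atTop < d) : ∀ᶠ u in atTop, f u < d :=
    eventually_lt_of_limsup_lt hd h_above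
  obtain ⟨U, hU, hfU⟩ := mapClusterPt_iff_ultrafilter.1
    (isGreatest_mapClusterPt_limsup h_below.isCoboundedUnder_le h_above).1
  have h_mean_pos : 0 < ∑ a, p a * l a :=
    Finset.sum_pos (fun a _ => mul_pos (hp a) (hl a)) Finset.univ_nonempty
  refine hf_lt c (lt_of_le_of_lt (le_of_forall_pos_sub_le fun ε hε => ?_) hc)
  rw [le_div_iff₀ h_mean_pos]
  simpa only [mul_div_cancel₀ ε (two_ne_zero' ℝ)] using
    sub_mul_sum_mul_le_of_tendsto hp hsum hl hl_dense hf_uc hk hf hκ hf_lt hU hfU (half_pos hε)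

theorem tendsto_of_renewal [Nonempty A] {B κ : ℝ} (hp : ∀ a, 0 < p a) (hsum : ∑ a, p a = 1)
    (hl : ∀ a, 0 < l a) (hl_dense : Dense (AddSubgroup.closure (Set.range l) : Set ℝ))
    (hB : ∀ u, |f u| ≤ B) (hf_uc : UniformContinuous f) (hk : Tendsto k atTop (𝓝 0))
    (hf : ∀ u, f u = k u + ∑ a, p a * f (u - l a))
    (hκ : Tendsto (fun u => ∑ a, p a * ∫ t in (u - l a)..u, f t) atTop (𝓝 κ)) :
    Tendsto f atTop (𝓝 (κ / ∑ a, p a * l a)) := by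
  refine tendsto_order.2 ⟨fun c hc => ?_, fun c hc =>
    eventually_lt_of_renewal hp hsum hl hl_dense hB hf_uc hk hf hκ hc⟩
  have h_neg : ∀ᶠ u in atTop, -f u < -c := by
    refine eventually_lt_of_renewal (k := fun u => -k u) (κ := -κ) hp hsum hl hl_dense
      (fun u => by simpa only [abs_neg] using hB u) hf_uc.neg (by simpa using hk.neg)
      (fun u => ?_) ?_ (by rwa [neg_div, neg_lt_neg_iff])
    · rw [hf u]
      simp only [mul_neg, Finset.sum_neg_distrib, neg_add]
    · simpa only [intervalIntegral.integral_neg, mul_neg, Finset.sum_neg_distrib] using hκ.neg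
  exact h_neg.mono fun u hu => neg_lt_neg_iff.1 hu

end Renewal

section Limit

lemma uniformContinuous_of_le_exp_mul {f : ℝ → ℝ} {B : ℝ} (hB : ∀ u, f u ≤ B)
    (hf : ∀ u v, f u ≤ Real.exp |u - v| * f v) : UniformContinuous f := by
  have h_sub (u v : ℝ) : f u - f v ≤ (Real.exp |u - v| - 1) * B := by
    have h_exp : 0 ≤ Real.exp |u - v| - 1 := sub_nonneg.2 (Real.one_le_exp (abs_nonneg _))
    linarith [hf u v, mul_le_mul_of_nonneg_left (hB v) h_exp]
  have h_lim : Tendsto (fun d => (Real.exp |d| - 1) * B) (𝓝 0) (𝓝 0) :=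
    Continuous.tendsto' (by fun_prop) _ _ (by simp)
  refine Metric.uniformContinuous_iff.2 fun ε hε => ?_
  obtain ⟨δ, hδ, h_ball⟩ := Metric.eventually_nhds_iff.1 (h_lim.eventually (gt_mem_nhds hε))
  refine ⟨δ, hδ, fun {u v} huv => ?_⟩
  refine lt_of_le_of_lt ?_ (h_ball (y := u - v) (by rwa [dist_zero_right]))
  exact abs_sub_le_iff.2 ⟨h_sub u v, by simpa only [abs_sub_comm] using h_sub v u⟩

variable {A : Type*} {p : A → ℝ}

lemma exp_sub_neg_log {x : ℝ} (hx : 0 < x) (u : ℝ) :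
    Real.exp (u - -Real.log x) = x * Real.exp u := by
  rw [sub_neg_eq_add, Real.exp_add, Real.exp_log hx, mul_comm]

/-- The normalised mean size `S(t) / t` as a function of `u = ln t`, for which the functional
equation of `S` becomes a renewal equation. -/
noncomputable def logMeanSize (p : A → ℝ) (u : ℝ) : ℝ := meanSize p (Real.exp u) / Real.exp u

variable [Fintype A]

lemma neg_log_pos [Nontrivial A] (hp : ∀ a, 0 < p a) (hsum : ∑ a, p a = 1) (a : A) :
    0 < -Real.log (p a) :=
  neg_pos.2 (Real.log_neg (hp a) (lt_one_of_sum_eq_one hp hsum a))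

lemma entropy_eq_sum (p : A → ℝ) : entropy p = ∑ a, p a * -Real.log (p a) := by
  simp only [entropy, mul_neg, Finset.sum_neg_distrib]

lemma logMeanSize_le_exp_mul (hp : ∀ a, 0 ≤ p a) (hsq : ∑ a, p a ^ 2 < 1) (u v : ℝ) :
    logMeanSize p u ≤ Real.exp |u - v| * logMeanSize p v := by
  have hu := Real.exp_pos u
  have hv := Real.exp_pos v
  rw [logMeanSize, div_le_iff₀ hu]
  rcases le_total v u with huv | huv
  · rw [abs_of_nonneg (sub_nonneg.2 huv)]
    have h_exp : Real.exp u = Real.exp (u - v) * Real.exp v := by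
      rw [← Real.exp_add, sub_add_cancel]
    calc meanSize p (Real.exp u) ≤ Real.exp (u - v) ^ 2 * meanSize p (Real.exp v) := by
          rw [h_exp]
          exact meanSize_mul_le hp hsq (Real.one_le_exp (sub_nonneg.2 huv)) hv.le
      _ = Real.exp (u - v) * logMeanSize p v * Real.exp u := by
          rw [logMeanSize, h_exp]
          field_simp
  · rw [abs_of_nonpos (sub_nonpos.2 huv), neg_sub]
    calc meanSize p (Real.exp u) ≤ meanSize p (Real.exp v) :=
          meanSize_monotoneOn hp hsq hu.le hv.le (Real.exp_le_exp.2 huv)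
      _ = Real.exp (v - u) * logMeanSize p v * Real.exp u := by
          rw [logMeanSize, Real.exp_sub]
          field_simp

lemma exists_abs_logMeanSize_le [Nontrivial A] (hp : ∀ a, 0 < p a) (hsum : ∑ a, p a = 1) :
    ∃ B, ∀ u, |logMeanSize p u| ≤ B := by
  obtain ⟨B, hB⟩ := exists_meanSize_le_mul hp hsum
  refine ⟨B, fun u => ?_⟩
  have hu := Real.exp_pos u
  rw [logMeanSize, abs_of_nonneg (div_nonneg (meanSize_nonneg (fun a => (hp a).le) hu.le) hu.le),
    div_le_iff₀ hu]
  exact hB _ hu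

lemma uniformContinuous_logMeanSize [Nontrivial A] (hp : ∀ a, 0 < p a) (hsum : ∑ a, p a = 1) :
    UniformContinuous (logMeanSize p) := by
  obtain ⟨B, hB⟩ := exists_abs_logMeanSize_le hp hsum
  exact uniformContinuous_of_le_exp_mul (fun u => (le_abs_self _).trans (hB u))
    (logMeanSize_le_exp_mul (fun a => (hp a).le) (sum_sq_lt_one hp hsum))

lemma logMeanSize_eq (hp : ∀ a, 0 < p a) (hsq : ∑ a, p a ^ 2 < 1) (u : ℝ) :
    logMeanSize p u = poissonTail (Real.exp u) / Real.exp u +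
      ∑ a, p a * logMeanSize p (u - -Real.log (p a)) := by
  have h_term (a : A) : p a * logMeanSize p (u - -Real.log (p a)) =
      meanSize p (p a * Real.exp u) / Real.exp u := by
    rw [logMeanSize, exp_sub_neg_log (hp a)]
    have := (hp a).ne'
    field_simp
  simp_rw [h_term]
  rw [logMeanSize, meanSize_eq_poissonTail_add_sum (fun a => (hp a).le) hsq (Real.exp_pos u).le,
    add_div, Finset.sum_div]

lemma integral_logMeanSize [Nontrivial A] (hp : ∀ a, 0 < p a) (hsum : ∑ a, p a = 1) (u v : ℝ) :
    ∫ s in u..v, logMeanSize p s =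
      ∫ t in (Real.exp u)..(Real.exp v), meanSize p t / t ^ 2 := by
  have h_pos (t : ℝ) (ht : t ∈ Set.uIcc (Real.exp u) (Real.exp v)) : 0 < t :=
    (lt_min (Real.exp_pos u) (Real.exp_pos v)).trans_le ht.1
  have h_subst := intervalIntegral.integral_comp_mul_deriv (f := Real.log) (f' := fun t => t⁻¹)
    (fun t ht => Real.hasDerivAt_log (h_pos t ht).ne')
    (continuousOn_inv₀.mono fun t ht => (h_pos t ht).ne')
    (uniformContinuous_logMeanSize hp hsum).continuous
  rw [Real.log_exp, Real.log_exp] at h_subst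
  rw [← h_subst]
  refine intervalIntegral.integral_congr fun t ht => ?_
  simp only [Function.comp_apply, logMeanSize, Real.exp_log (h_pos t ht)]
  field_simp

lemma tendsto_sum_mul_integral_logMeanSize [Nontrivial A] (hp : ∀ a, 0 < p a)
    (hsum : ∑ a, p a = 1) :
    Tendsto (fun u => ∑ a, p a * ∫ s in (u - -Real.log (p a))..u, logMeanSize p s)
      atTop (𝓝 1) := by
  have h_lim := (intervalIntegral_tendsto_integral_Ioi 0 integrableOn_poissonTail_div_sq
    tendsto_id).comp Real.tendsto_exp_atTop
  rw [integral_poissonTail_div_sq] at h_lim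
  refine h_lim.congr fun u => ?_
  simp only [integral_logMeanSize hp hsum, exp_sub_neg_log (hp _)]
  exact (sum_mul_integral_meanSize_div_sq hp (sum_sq_lt_one hp hsum) hsum (Real.exp_pos u).le).symm

lemma tendsto_poissonTail_exp_div_exp :
    Tendsto (fun u => poissonTail (Real.exp u) / Real.exp u) atTop (𝓝 0) := by
  refine squeeze_zero (fun u => div_nonneg (poissonTail_nonneg (Real.exp_pos u).le)
    (Real.exp_pos u).le) (fun u => ?_) Real.tendsto_exp_neg_atTop_nhds_zero
  rw [Real.exp_neg, ← one_div]
  exact div_le_div_of_nonneg_right (poissonTail_le_one (Real.exp_pos u).le) (Real.exp_pos u).le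

theorem tendsto_meanSize_div [Nontrivial A] (hp : ∀ a, 0 < p a) (hsum : ∑ a, p a = 1)
    (hd : period p = 0) : Tendsto (fun t => meanSize p t / t) atTop (𝓝 (entropy p)⁻¹) := by
  obtain ⟨B, hB⟩ := exists_abs_logMeanSize_le hp hsum
  obtain ⟨a⟩ := (inferInstance : Nonempty A)
  have hl := neg_log_pos hp hsum
  have h_dense := dense_closure_of_realGcd_eq_zero (Set.mem_range_self a) (hl a).ne' hd
  have h_lim := tendsto_of_renewal hp hsum hl h_dense hB (uniformContinuous_logMeanSize hp hsum)
    tendsto_poissonTail_exp_div_exp (logMeanSize_eq hp (sum_sq_lt_one hp hsum))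
    (tendsto_sum_mul_integral_logMeanSize hp hsum)
  rw [← entropy_eq_sum, one_div] at h_lim
  refine (h_lim.comp Real.tendsto_log_atTop).congr' ?_
  filter_upwards [eventually_gt_atTop 0] with t ht
  simp only [Function.comp_apply, logMeanSize, Real.exp_log ht]

end Limit

section SimultaneousApproximation

lemma abs_sub_sub_floor_sub_floor_le {Q x y : ℝ} (hQ : 0 < Q)
    (h : ⌊Q * Int.fract x⌋ = ⌊Q * Int.fract y⌋) : |x - y - (⌊x⌋ - ⌊y⌋)| ≤ 1 / Q := by
  have h_lt := Int.abs_sub_lt_one_of_floor_eq_floor h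
  rw [← mul_sub, abs_mul, abs_of_pos hQ] at h_lt
  rw [le_div_iff₀' hQ, sub_sub_sub_comm]
  exact h_lt.le

lemma exists_nat_forall_abs_mul_sub_le {ι : Type*} [Fintype ι] (α : ι → ℝ) {Q : ℕ} (hQ : 0 < Q) :
    ∃ m : ℕ, 0 < m ∧ m ≤ Q ^ Fintype.card ι ∧ ∀ i, ∃ k : ℤ, |m * α i - k| ≤ 1 / Q := by
  classical
  have hQ' : (0 : ℝ) < Q := by exact_mod_cast hQ
  have h_maps : Set.MapsTo (fun (m : ℕ) (i : ι) => ⌊Q * Int.fract (m * α i)⌋)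
      (Finset.range (Q ^ Fintype.card ι + 1))
      (Fintype.piFinset fun _ : ι => Finset.Ico (0 : ℤ) Q) := by
    intro m _
    refine Fintype.mem_piFinset.2 fun i => Finset.mem_Ico.2
      ⟨Int.floor_nonneg.2 (mul_nonneg hQ'.le (Int.fract_nonneg _)), Int.floor_lt.2 ?_⟩
    exact mul_lt_of_lt_one_right hQ' (Int.fract_lt_one _)
  obtain ⟨m, hm, m', hm', hne, h_eq⟩ := Finset.exists_ne_map_eq_of_card_lt_of_maps_to
    (by simp) h_maps
  wlog h_lt : m' < m generalizing m m'
  · exact this m' hm' m hm hne.symm h_eq.symm (lt_of_le_of_ne (not_lt.1 h_lt) hne)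
  rw [Finset.mem_range] at hm
  refine ⟨m - m', by omega, by omega, fun i => ⟨⌊m * α i⌋ - ⌊m' * α i⌋, ?_⟩⟩
  rw [Nat.cast_sub h_lt.le, sub_mul]
  push_cast
  exact abs_sub_sub_floor_sub_floor_le hQ' (congrFun h_eq i)

/-- `y` is a period, up to an error `δ` in the phases, of all the functions `t ↦ exp (i * l a * t)`.
At such a point `1 + i * y` the Dirichlet polynomial `∑ a, exp (-l a * s)` is close to its value at
`s = 1`. -/
def IsAlmostPeriod {A : Type*} (l : A → ℝ) (δ y : ℝ) : Prop :=
  ∀ a, ∃ k : ℤ, |y * l a - 2 * Real.pi * k| ≤ δ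

variable {A : Type*} {l : A → ℝ}

lemma exists_not_isAlmostPeriod {a₀ : A} (hl : l a₀ ≠ 0) (h_gcd : realGcd (Set.range l) = 0) {y : ℝ}
    (hy : 0 < y) : ∃ δ > 0, ¬ IsAlmostPeriod l δ y := by
  obtain ⟨a, ha⟩ : ∃ a, ∀ k : ℤ, y * l a ≠ 2 * Real.pi * k := by
    by_contra! h
    have h_pos : 0 < 2 * Real.pi / y := div_pos Real.two_pi_pos hy
    refine (h_pos.trans_le (le_realGcd (Set.mem_range_self a₀) hl h_pos ?_)).ne' h_gcd
    rintro _ ⟨a, rfl⟩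
    obtain ⟨k, hk⟩ := h a
    exact ⟨k, by field_simp; linarith⟩
  set x := y * l a / (2 * Real.pi)
  have hx (k : ℤ) : y * l a - 2 * Real.pi * k = 2 * Real.pi * (x - k) := by
    rw [mul_sub, mul_div_cancel₀ _ Real.two_pi_pos.ne']
  have h_dist : 0 < |x - round x| := by
    refine abs_pos.2 fun h => ha (round x) (sub_eq_zero.1 ?_)
    rw [hx, h, mul_zero]
  refine ⟨2 * Real.pi * (|x - round x| / 2), by positivity, fun h => ?_⟩
  obtain ⟨k, hk⟩ := h a
  rw [hx, abs_mul, abs_of_pos Real.two_pi_pos, mul_le_mul_iff_right₀ Real.two_pi_pos] at hk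
  linarith [round_le x k]

variable [Fintype A]

lemma exists_isAlmostPeriod_le_pow {a₀ : A} (hl : l a₀ ≠ 0) {Q : ℕ} (hQ : 0 < Q) :
    ∃ m : ℕ, 0 < m ∧ m ≤ Q ^ (Fintype.card A - 1) ∧
      IsAlmostPeriod l (2 * Real.pi / Q) (2 * Real.pi * m / l a₀) := by
  classical
  obtain ⟨m, hm, hmQ, hmk⟩ := exists_nat_forall_abs_mul_sub_le
    (fun a : {a // a ≠ a₀} => l a / l a₀) hQ
  refine ⟨m, hm, by simpa only [Fintype.card_subtype_compl, Fintype.card_unique] using hmQ,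
    fun a => ?_⟩
  have h_eq (k : ℤ) : 2 * Real.pi * m / l a₀ * l a - 2 * Real.pi * k =
      2 * Real.pi * (m * (l a / l a₀) - k) := by ring
  obtain ⟨k, hk⟩ : ∃ k : ℤ, |m * (l a / l a₀) - k| ≤ 1 / Q := by
    by_cases ha : a = a₀
    · exact ⟨m, by simp [ha, div_self hl]⟩
    · exact hmk ⟨a, ha⟩
  refine ⟨k, ?_⟩
  rw [h_eq, abs_mul, abs_of_pos Real.two_pi_pos, div_eq_mul_one_div (2 * Real.pi)]
  exact mul_le_mul_of_nonneg_left hk Real.two_pi_pos.le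

lemma exists_isAlmostPeriod_gt {a₀ : A} (hl : 0 < l a₀) (h_gcd : realGcd (Set.range l) = 0)
    (M Q₀ : ℕ) : ∃ m Q : ℕ, M < m ∧ Q₀ ≤ Q ∧ 0 < Q ∧ m ≤ Q ^ (Fintype.card A - 1) ∧
      IsAlmostPeriod l (2 * Real.pi / Q) (2 * Real.pi * m / l a₀) := by
  have h_small (m : ℕ) (hm : m ∈ Finset.Icc 1 M) : ∀ᶠ Q : ℕ in atTop,
      ¬ IsAlmostPeriod l (2 * Real.pi / Q) (2 * Real.pi * m / l a₀) := by
    have hm₀ : (0 : ℝ) < m := by exact_mod_cast (Finset.mem_Icc.1 hm).1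
    obtain ⟨δ, hδ, h_not⟩ := exists_not_isAlmostPeriod hl.ne' h_gcd
      (div_pos (mul_pos Real.two_pi_pos hm₀) hl)
    filter_upwards [(tendsto_const_div_atTop_nhds_zero_nat _).eventually (gt_mem_nhds hδ)]
      with Q hQ h
    exact h_not fun a => (h a).imp fun k hk => hk.trans hQ.le
  obtain ⟨Q, ⟨hQ, hQ₀⟩, hQ_pos⟩ := ((((Finset.eventually_all _).2 h_small).and
    (eventually_ge_atTop Q₀)).and (eventually_gt_atTop 0)).exists
  obtain ⟨m, hm₀, hmQ, hm⟩ := exists_isAlmostPeriod_le_pow hl.ne' hQ_pos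
  exact ⟨m, Q, not_le.1 fun hmM => hQ m (Finset.mem_Icc.2 ⟨hm₀, hmM⟩) hm, hQ₀, hQ_pos, hmQ, hm⟩

lemma exists_isAlmostPeriod [Nontrivial A] (hl : ∀ a, 0 < l a)
    (h_gcd : realGcd (Set.range l) = 0) :
    ∃ C > 0, ∀ Y, ∀ δ₀ > 0, ∃ y δ, Y ≤ y ∧ 0 < y ∧ 0 < δ ∧ δ ≤ δ₀ ∧
      δ ≤ C * y ^ (-(1 / ((Fintype.card A : ℝ) - 1))) ∧ IsAlmostPeriod l δ y := by
  obtain ⟨a₀⟩ := (inferInstance : Nonempty A)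
  have hl₀ := hl a₀
  have h_pi := Real.two_pi_pos
  have hn : (0 : ℝ) < (Fintype.card A : ℝ) - 1 := sub_pos.2 (by exact_mod_cast Fintype.one_lt_card)
  refine ⟨2 * Real.pi * (l a₀ / (2 * Real.pi)) ^ (-(1 / ((Fintype.card A : ℝ) - 1))),
    by positivity, fun Y δ₀ hδ₀ => ?_⟩
  obtain ⟨M, hM⟩ := exists_nat_ge (Y * l a₀ / (2 * Real.pi))
  obtain ⟨Q₀, hQ₀⟩ := exists_nat_ge (2 * Real.pi / δ₀)
  obtain ⟨m, Q, hMm, hQ₀Q, hQ, hmQ, hm⟩ := exists_isAlmostPeriod_gt hl₀ h_gcd M Q₀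
  have hm₀ : (0 : ℝ) < m := by exact_mod_cast (Nat.zero_le M).trans_lt hMm
  have hQ' : (0 : ℝ) < Q := by exact_mod_cast hQ
  refine ⟨_, _, ?_, by positivity, by positivity, ?_, ?_, hm⟩
  · have h := hM.trans (Nat.cast_le.2 hMm.le)
    rw [le_div_iff₀ hl₀, mul_comm _ (m : ℝ)]
    rwa [div_le_iff₀ h_pi] at h
  · have h := hQ₀.trans (Nat.cast_le.2 hQ₀Q)
    rwa [div_le_comm₀ hQ' hδ₀]
  · have h_eq : l a₀ / (2 * Real.pi) * (2 * Real.pi * m / l a₀) = m := by field_simp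
    rw [mul_assoc, ← Real.mul_rpow (by positivity) (by positivity), h_eq, div_eq_mul_inv,
      Real.rpow_neg hm₀.le, one_div]
    refine mul_le_mul_of_nonneg_left (inv_anti₀ (by positivity) ?_) h_pi.le
    rw [Real.rpow_inv_le_iff_of_pos hm₀.le hQ'.le hn]
    have hmQ' : (m : ℝ) ≤ (Q : ℝ) ^ (Fintype.card A - 1) := by exact_mod_cast hmQ
    rwa [← Real.rpow_natCast, Nat.cast_pred Fintype.card_pos] at hmQ'

end SimultaneousApproximation

section CharacteristicRoots

lemma exists_eq_zero_of_norm_sub_linear_le {f : ℂ → ℂ} (hf : Differentiable ℂ f) {c z₀ : ℂ}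
    {r ε : ℝ} (hr : 0 < r) (hε : 4 * ε < ‖c‖ * r)
    (h_le : ∀ z, ‖z - z₀‖ ≤ r → ‖f z - c * (z - z₀)‖ ≤ ε) : ∃ z, ‖z - z₀‖ ≤ r ∧ f z = 0 := by
  have h_center : ‖f z₀‖ ≤ ε := by simpa using h_le z₀ (by simpa using hr.le)
  have h_sphere (z : ℂ) (hz : ‖z - z₀‖ = r) : ‖c‖ * r - 2 * ε ≤ ‖f z - f z₀‖ := by
    have h_eq : f z - f z₀ = c * (z - z₀) - (f z₀ - (f z - c * (z - z₀))) := by ring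
    have h_sub := norm_sub_norm_le (c * (z - z₀)) (f z₀ - (f z - c * (z - z₀)))
    rw [← h_eq, norm_mul, hz] at h_sub
    linarith [norm_sub_le (f z₀) (f z - c * (z - z₀)), h_le z hz.le]
  have h_ne : ∃ᶠ z in 𝓝 z₀, f z ≠ f z₀ := by
    intro h_const
    simp only [not_not] at h_const
    have h_eq := AnalyticOnNhd.eqOn_of_preconnected_of_eventuallyEq (fun z _ => hf.analyticAt z)
      analyticOnNhd_const isPreconnected_univ (Set.mem_univ z₀) h_const
    have h := h_sphere (z₀ + r) (by simp [abs_of_pos hr])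
    rw [h_eq (Set.mem_univ _), sub_self, norm_zero] at h
    linarith [norm_nonneg (f z₀)]
  obtain ⟨z, hz, hfz⟩ := hf.diffContOnCl.ball_subset_image_closedBall hr
    (fun z hz => h_sphere z (mem_sphere_iff_norm.1 hz)) h_ne
    (show (0 : ℂ) ∈ Metric.ball (f z₀) ((‖c‖ * r - 2 * ε) / 2) by
      rw [mem_ball_iff_norm, zero_sub, norm_neg]; linarith)
  exact ⟨z, mem_closedBall_iff_norm.1 hz, hfz⟩

lemma ofReal_cpow_eq_mul_exp {x : ℝ} (hx : 0 < x) (s : ℂ) (y : ℝ) (k : ℤ) :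
    (x : ℂ) ^ s = x * Complex.exp (-((s - (1 + y * Complex.I)) * (-Real.log x : ℝ)) -
      (y * -Real.log x - 2 * Real.pi * k : ℝ) * Complex.I) := by
  have hx' : (x : ℂ) ≠ 0 := Complex.ofReal_ne_zero.2 hx.ne'
  nth_rw 2 [← Complex.exp_log hx']
  rw [Complex.cpow_def_of_ne_zero hx', ← Complex.exp_add, Complex.exp_eq_exp_iff_exists_int]
  refine ⟨-k, ?_⟩
  rw [← Complex.ofReal_log hx.le]
  push_cast
  ring

variable {A : Type*} [Fintype A] {p : A → ℝ}

lemma norm_sum_smul_le {E : Type*} [SeminormedAddCommGroup E] [NormedSpace ℝ E] {r : ℝ} {z : A → E}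
    (hp : ∀ a, 0 ≤ p a) (hsum : ∑ a, p a = 1) (hz : ∀ a, ‖z a‖ ≤ r) : ‖∑ a, p a • z a‖ ≤ r := by
  rw [← one_mul r, ← hsum, Finset.sum_mul]
  refine norm_sum_le_of_le _ fun a _ => ?_
  rw [norm_smul, Real.norm_of_nonneg (hp a)]
  exact mul_le_mul_of_nonneg_left (hz a) (hp a)

lemma norm_sum_mul_exp_sub_le {r : ℝ} {z : A → ℂ} (hp : ∀ a, 0 ≤ p a) (hsum : ∑ a, p a = 1)
    (hr : r ≤ 1) (hz : ∀ a, ‖z a‖ ≤ r) :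
    ‖∑ a, (p a : ℂ) * Complex.exp (z a) - 1 - ∑ a, (p a : ℂ) * z a‖ ≤ r ^ 2 := by
  have h_eq : ∑ a, (p a : ℂ) * Complex.exp (z a) - 1 - ∑ a, (p a : ℂ) * z a =
      ∑ a, p a • (Complex.exp (z a) - 1 - z a) := by
    have hsum' : ∑ a, (p a : ℂ) = 1 := by exact_mod_cast hsum
    simp_rw [Complex.real_smul, mul_sub, Finset.sum_sub_distrib, mul_one, hsum']
  rw [h_eq]
  refine norm_sum_smul_le hp hsum fun a => ?_
  exact (Complex.norm_exp_sub_one_sub_id_le ((hz a).trans hr)).trans (by gcongr; exact hz a)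

lemma exists_forall_norm_sum_cpow_sub_linear_le [Nontrivial A] (hp : ∀ a, 0 < p a)
    (hsum : ∑ a, p a = 1) {M r δ y : ℝ} (hM : ∀ a, -Real.log (p a) ≤ M)
    (hy : IsAlmostPeriod (fun a => -Real.log (p a)) δ y) (hr : r * M + δ ≤ 1) :
    ∃ t : ℝ, |t| ≤ δ ∧ ∀ s : ℂ, ‖s - (1 + y * Complex.I)‖ ≤ r →
      ‖∑ a, (p a : ℂ) ^ s - 1 + entropy p * (s - (1 + y * Complex.I)) + t * Complex.I‖ ≤
        (r * M + δ) ^ 2 := by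
  choose k hk using hy
  refine ⟨∑ a, p a • (y * -Real.log (p a) - 2 * Real.pi * k a),
    Real.norm_eq_abs _ ▸ norm_sum_smul_le (fun a => (hp a).le) hsum hk, fun s hs => ?_⟩
  set z : A → ℂ := fun a => -((s - (1 + y * Complex.I)) * (-Real.log (p a) : ℝ)) -
    (y * -Real.log (p a) - 2 * Real.pi * k a : ℝ) * Complex.I with hz_def
  have hz (a : A) : ‖z a‖ ≤ r * M + δ := by
    have hl := neg_log_pos hp hsum a
    refine norm_sub_le_of_le ?_ ?_
    · rw [norm_neg, norm_mul, Complex.norm_real, Real.norm_of_nonneg hl.le]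
      exact mul_le_mul hs (hM a) hl.le ((norm_nonneg _).trans hs)
    · rw [norm_mul, Complex.norm_I, mul_one, Complex.norm_real]
      exact hk a
  have h_linear : ∑ a, (p a : ℂ) * z a = -(entropy p * (s - (1 + y * Complex.I)) +
      (∑ a, p a • (y * -Real.log (p a) - 2 * Real.pi * k a) : ℝ) * Complex.I) := by
    rw [entropy_eq_sum, hz_def]
    push_cast
    rw [Finset.sum_mul, Finset.sum_mul, ← Finset.sum_add_distrib, ← Finset.sum_neg_distrib]
    refine Finset.sum_congr rfl fun a _ => ?_
    simp only [smul_eq_mul]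
    push_cast
    ring
  have h := norm_sum_mul_exp_sub_le (fun a => (hp a).le) hsum hr hz
  rwa [h_linear, sub_neg_eq_add, ← add_assoc,
    Finset.sum_congr rfl fun a _ => (ofReal_cpow_eq_mul_exp (hp a) s y (k a)).symm] at h

lemma differentiable_sum_ofReal_cpow (hp : ∀ a, 0 < p a) :
    Differentiable ℂ fun s : ℂ => ∑ a, (p a : ℂ) ^ s :=
  Differentiable.fun_sum fun a _ =>
    differentiable_id.const_cpow (.inl (Complex.ofReal_ne_zero.2 (hp a).ne'))

lemma entropy_pos [Nontrivial A] (hp : ∀ a, 0 < p a) (hsum : ∑ a, p a = 1) : 0 < entropy p := by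
  rw [entropy_eq_sum]
  exact Finset.sum_pos (fun a _ => mul_pos (hp a) (neg_log_pos hp hsum a)) Finset.univ_nonempty

-- The linear part vanishes at a point with real part `1`, so the real part of the root is off by
-- no more than the quadratic error.
lemma exists_root_near_almostPeriod [Nontrivial A] (hp : ∀ a, 0 < p a) (hsum : ∑ a, p a = 1)
    {M δ y : ℝ} (hM : ∀ a, -Real.log (p a) ≤ M) (hδ : 0 < δ)
    (hM_δ : (9 / entropy p * M + 1) ^ 2 * δ ≤ 1)
    (hy : IsAlmostPeriod (fun a => -Real.log (p a)) δ y) :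
    ∃ s : ℂ, ∑ a, (p a : ℂ) ^ s = 1 ∧ ‖s - (1 + y * Complex.I)‖ ≤ 9 * δ / entropy p ∧
      |s.re - 1| ≤ ((9 / entropy p * M + 1) * δ) ^ 2 / entropy p := by
  have hH := entropy_pos hp hsum
  have hM₀ : 0 ≤ M := by
    obtain ⟨a⟩ := (inferInstance : Nonempty A)
    exact (neg_log_pos hp hsum a).le.trans (hM a)
  set τ := 9 / entropy p * M + 1 with hτ
  have hτ₁ : 1 ≤ τ := by linarith [show 0 ≤ 9 / entropy p * M by positivity]
  have h_radius : 9 * δ / entropy p * M + δ = τ * δ := by rw [hτ]; ring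
  have h_sq : (τ * δ) ^ 2 ≤ δ := by nlinarith
  have h_one : τ * δ ≤ 1 := by nlinarith
  obtain ⟨t, ht, h_linear⟩ := exists_forall_norm_sum_cpow_sub_linear_le hp hsum hM hy
    (h_radius.trans_le h_one)
  rw [h_radius] at h_linear
  have ht' : ‖(t : ℂ) * Complex.I‖ ≤ δ := by
    rwa [norm_mul, Complex.norm_I, mul_one, Complex.norm_real]
  obtain ⟨s, hs, hs_root⟩ := exists_eq_zero_of_norm_sub_linear_le (ε := 2 * δ)
    (c := -entropy p) (z₀ := 1 + y * Complex.I) (r := 9 * δ / entropy p)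
    ((differentiable_sum_ofReal_cpow hp).sub_const 1) (by positivity)
    (by rw [norm_neg, Complex.norm_real, Real.norm_of_nonneg hH.le]; field_simp; linarith)
    fun s hs => by
      have h := norm_sub_le_of_le (h_linear s hs) ht'
      rw [add_sub_cancel_right] at h
      rw [neg_mul, sub_neg_eq_add]
      linarith
  refine ⟨s, sub_eq_zero.1 hs_root, hs, ?_⟩
  have h := (Complex.abs_re_le_norm _).trans (h_linear s hs)
  rw [hs_root, zero_add] at h
  have h_re : (entropy p * (s - (1 + y * Complex.I)) + t * Complex.I).re =
      entropy p * (s.re - 1) := by simp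
  rwa [h_re, abs_mul, abs_of_pos hH, ← le_div_iff₀' hH] at h

lemma exists_root_of_isAlmostPeriod [Nontrivial A] (hp : ∀ a, 0 < p a) (hsum : ∑ a, p a = 1) :
    ∃ K > 0, ∃ δ₀ > 0, ∀ δ y, 0 < δ → δ ≤ δ₀ → IsAlmostPeriod (fun a => -Real.log (p a)) δ y →
      ∃ s : ℂ, ∑ a, (p a : ℂ) ^ s = 1 ∧ ‖s - (1 + y * Complex.I)‖ ≤ 1 / 2 ∧
        |s.re - 1| ≤ K * δ ^ 2 := by
  have hH := entropy_pos hp hsum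
  obtain ⟨M, hM⟩ := Finite.bddAbove_range fun a => -Real.log (p a)
  replace hM (a : A) : -Real.log (p a) ≤ M := hM ⟨a, rfl⟩
  have hM₀ : 0 ≤ M := by
    obtain ⟨a⟩ := (inferInstance : Nonempty A)
    exact (neg_log_pos hp hsum a).le.trans (hM a)
  refine ⟨(9 / entropy p * M + 1) ^ 2 / entropy p, by positivity,
    min (1 / (9 / entropy p * M + 1) ^ 2) (entropy p / 18), by positivity,
    fun δ y hδ hδ_le hy => ?_⟩
  obtain ⟨s, hs_root, hs, hs_re⟩ := exists_root_near_almostPeriod hp hsum hM hδ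
    ((le_div_iff₀' (by positivity)).1 (hδ_le.trans (min_le_left _ _))) hy
  refine ⟨s, hs_root, hs.trans ?_, hs_re.trans_eq (by ring)⟩
  rw [div_le_iff₀ hH]
  linarith [hδ_le.trans (min_le_right _ _)]

theorem exists_root_near_line [Nontrivial A] (hp : ∀ a, 0 < p a) (hsum : ∑ a, p a = 1)
    (hd : period p = 0) : ∃ C > 0, ∀ Y : ℝ, ∃ s : ℂ, ∑ a, (p a : ℂ) ^ s = 1 ∧ Y ≤ s.im ∧
      |s.re - 1| ≤ 1 / 2 ∧
      |s.re - 1| ≤ C * s.im ^ (-(2 / ((Fintype.card A : ℝ) - 1))) := by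
  obtain ⟨K, hK, δ₀, hδ₀, h_root⟩ := exists_root_of_isAlmostPeriod hp hsum
  obtain ⟨C, hC, h_period⟩ := exists_isAlmostPeriod (neg_log_pos hp hsum) hd
  set n := (Fintype.card A : ℝ) - 1
  have hn : 0 < n := sub_pos.2 (by exact_mod_cast Fintype.one_lt_card)
  refine ⟨K * C ^ 2 * 2⁻¹ ^ (-(2 / n)), by positivity, fun Y => ?_⟩
  obtain ⟨y, δ, hYy, hy₀, hδ, hδ_le, hδy, hy⟩ := h_period (max Y 0 + 1) δ₀ hδ₀
  obtain ⟨s, hs_root, hs, hs_re⟩ := h_root δ y hδ hδ_le hy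
  have h_re : |s.re - 1| ≤ 1 / 2 := by simpa using (Complex.abs_re_le_norm _).trans hs
  have h_im : |s.im - y| ≤ 1 / 2 := by simpa using (Complex.abs_im_le_norm _).trans hs
  have h_im_bounds := abs_le.1 h_im
  have hY := le_max_left Y 0
  have hY₀ := le_max_right Y 0
  have h_im_pos : 0 < s.im := by linarith
  refine ⟨s, hs_root, by linarith, h_re, hs_re.trans ?_⟩
  calc K * δ ^ 2 ≤ K * (C * y ^ (-(1 / n))) ^ 2 := by gcongr
    _ = K * C ^ 2 * y ^ (-(2 / n)) := by
        rw [mul_pow, ← Real.rpow_mul_natCast hy₀.le, mul_assoc]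
        ring_nf
    _ ≤ K * C ^ 2 * (2⁻¹ * s.im) ^ (-(2 / n)) := by
        refine mul_le_mul_of_nonneg_left ?_ (by positivity)
        exact Real.rpow_le_rpow_of_nonpos (by positivity) (by linarith)
          (neg_nonpos.2 (by positivity))
    _ = K * C ^ 2 * 2⁻¹ ^ (-(2 / n)) * s.im ^ (-(2 / n)) := by
        rw [Real.mul_rpow (by norm_num) h_im_pos.le, ← mul_assoc]

end CharacteristicRoots

section LowerBound

variable {A : Type*} [Fintype A] {p : A → ℝ}

lemma sum_cpow_mul_integral_cpow_neg_eq_zero (hp : ∀ a, 0 < p a) (hsum : ∑ a, p a = 1) {s : ℂ}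
    (hs_one : s ≠ 1) (hs : ∑ a, (p a : ℂ) ^ s = 1) {x : ℝ} (hx : 0 < x) :
    ∑ a, (p a : ℂ) ^ s * ∫ t in (p a * x)..x, (t : ℂ) ^ (-s) = 0 := by
  have h_term (a : A) : (p a : ℂ) ^ s * ∫ t in (p a * x)..x, (t : ℂ) ^ (-s) =
      ((p a : ℂ) ^ s - p a) * ((x : ℂ) ^ (1 - s) / (1 - s)) := by
    have hpa : (p a : ℂ) ≠ 0 := Complex.ofReal_ne_zero.2 (hp a).ne'
    have h_cpow : (p a : ℂ) ^ s * (p a : ℂ) ^ (1 - s) = p a := by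
      rw [← Complex.cpow_add _ _ hpa, add_sub_cancel, Complex.cpow_one]
    rw [integral_cpow (.inr ⟨by simpa using hs_one,
        Set.notMem_uIcc_of_lt (mul_pos (hp a) hx) hx⟩), neg_add_eq_sub, Complex.ofReal_mul,
      Complex.mul_cpow_ofReal_nonneg (hp a).le hx.le, mul_div_assoc', mul_sub, ← mul_assoc,
      h_cpow, ← sub_mul, mul_div_assoc]
  have hsum' : ∑ a, (p a : ℂ) = 1 := by exact_mod_cast hsum
  simp_rw [h_term, ← Finset.sum_mul, Finset.sum_sub_distrib, hs, hsum', sub_self, zero_mul]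

-- Since `∑ pₐ ^ s = ∑ pₐ = 1`, any multiple of `t` may be subtracted from the mean size.
lemma sum_cpow_mul_integral_meanSize_div_sub_eq (hp : ∀ a, 0 < p a) (hsum : ∑ a, p a = 1)
    (hsq : ∑ a, p a ^ 2 < 1) {s : ℂ} (hs_lt : s.re < 2) (hs_one : s ≠ 1)
    (hs : ∑ a, (p a : ℂ) ^ s = 1) {x : ℝ} (hx : 0 < x) (c : ℝ) :
    ∑ a, (p a : ℂ) ^ s * ∫ t in (p a * x)..x, (t : ℂ) ^ (-s) * (meanSize p t / t - c : ℝ) =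
      ∫ t in (0 : ℝ)..x, (t : ℂ) ^ (-s - 1) * poissonTail t := by
  have h_split (a : A) : ∫ t in (p a * x)..x, (t : ℂ) ^ (-s) * (meanSize p t / t - c : ℝ) =
      (∫ t in (p a * x)..x, (t : ℂ) ^ (-s - 1) * meanSize p t) -
        (∫ t in (p a * x)..x, (t : ℂ) ^ (-s)) * c := by
    have hpx := mul_pos (hp a) hx
    have h_notMem : (0 : ℝ) ∉ Set.uIcc (p a * x) x := Set.notMem_uIcc_of_lt hpx hx
    rw [← intervalIntegral.integral_mul_const, ← intervalIntegral.integral_sub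
      (intervalIntegrable_cpow_mul_meanSize (fun a => (hp a).le) hsq hs_lt hpx.le hx.le)
      ((intervalIntegral.intervalIntegrable_cpow (.inr h_notMem)).mul_const _)]
    refine intervalIntegral.integral_congr fun t ht => ?_
    have ht₀ : (t : ℂ) ≠ 0 := by
      rintro h
      exact h_notMem (Complex.ofReal_eq_zero.1 h ▸ ht)
    simp only [Complex.cpow_sub _ _ ht₀, Complex.cpow_one]
    push_cast
    ring
  simp_rw [h_split, mul_sub, ← mul_assoc, Finset.sum_sub_distrib, ← Finset.sum_mul,
    sum_cpow_mul_integral_cpow_neg_eq_zero hp hsum hs_one hs hx, zero_mul, sub_zero]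
  exact sum_cpow_mul_integral_meanSize_eq hp hsq hs_lt hs hx.le

lemma norm_integral_cpow_neg_mul_le {f : ℝ → ℝ} {s : ℂ} {q x η B : ℝ} (hx : 0 < x) (hq : q ≤ 1)
    (hqx : 1 ≤ q * x) (hη : 0 ≤ η) (hs : 1 - s.re ≤ η) (hf : ∀ t ∈ Set.Icc (q * x) x, |f t| ≤ B) :
    ‖∫ t in (q * x)..x, (t : ℂ) ^ (-s) * f t‖ ≤ q⁻¹ * (x ^ η * B) := by
  have h_le : q * x ≤ x := mul_le_of_le_one_left hx.le hq
  have hqx₀ : 0 < q * x := by linarith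
  have hB : 0 ≤ B := (abs_nonneg _).trans (hf x ⟨h_le, le_rfl⟩)
  have h_bound (t : ℝ) (ht : t ∈ Set.uIoc (q * x) x) :
      ‖(t : ℂ) ^ (-s) * f t‖ ≤ (q * x)⁻¹ * x ^ η * B := by
    rw [Set.uIoc_of_le h_le] at ht
    have ht₀ : 0 < t := hqx₀.trans ht.1
    rw [norm_mul, Complex.norm_real, Complex.norm_cpow_eq_rpow_re_of_pos ht₀]
    refine mul_le_mul ?_ (hf t (Set.Ioc_subset_Icc_self ht)) (norm_nonneg _) (by positivity)
    calc t ^ (-s).re = t⁻¹ * t ^ (1 - s.re) := by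
          rw [← Real.rpow_neg_one, ← Real.rpow_add ht₀, Complex.neg_re]
          ring_nf
      _ ≤ (q * x)⁻¹ * x ^ η := by
          gcongr
          · exact ht.1.le
          · exact (Real.rpow_le_rpow_of_exponent_le (hqx.trans ht.1.le) hs).trans
              (Real.rpow_le_rpow ht₀.le ht.2 hη)
  calc _ ≤ (q * x)⁻¹ * x ^ η * B * |x - q * x| :=
        intervalIntegral.norm_integral_le_of_norm_le_const h_bound
    _ ≤ (q * x)⁻¹ * x ^ η * B * x := by
        gcongr
        rw [abs_of_nonneg (sub_nonneg.2 h_le)]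
        linarith
    _ = q⁻¹ * (x ^ η * B) := by
        rw [mul_inv]
        field_simp

lemma norm_integral_poissonTail_le (hp : ∀ a, 0 < p a) (hsum : ∑ a, p a = 1)
    (hsq : ∑ a, p a ^ 2 < 1) {s : ℂ} (hs_nonneg : 0 ≤ s.re) (hs_lt : s.re < 2) (hs_one : s ≠ 1)
    (hs : ∑ a, (p a : ℂ) ^ s = 1) {c x η B : ℝ} (hx : 0 < x) (hpx : ∀ a, 1 ≤ p a * x)
    (hη : 0 ≤ η) (hs_η : 1 - s.re ≤ η)
    (hB : ∀ a, ∀ t ∈ Set.Icc (p a * x) x, |meanSize p t / t - c| ≤ B) :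
    ‖∫ t in (0 : ℝ)..x, (t : ℂ) ^ (-s - 1) * poissonTail t‖ ≤ (∑ a, (p a)⁻¹) * (x ^ η * B) := by
  rw [← sum_cpow_mul_integral_meanSize_div_sub_eq hp hsum hsq hs_lt hs_one hs hx c, Finset.sum_mul]
  refine norm_sum_le_of_le _ fun a _ => ?_
  have hp_le : p a ≤ 1 :=
    hsum ▸ Finset.single_le_sum (fun b _ => (hp b).le) (Finset.mem_univ a)
  have h_norm : ‖(p a : ℂ) ^ s‖ ≤ 1 := by
    rw [Complex.norm_cpow_eq_rpow_re_of_pos (hp a)]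
    exact Real.rpow_le_one (hp a).le hp_le hs_nonneg
  rw [norm_mul]
  exact (mul_le_of_le_one_left (norm_nonneg _) h_norm).trans
    (norm_integral_cpow_neg_mul_le hx hp_le (hpx a) hη hs_η (hB a))

lemma exp_neg_le_of_root (hp : ∀ a, 0 < p a) (hsum : ∑ a, p a = 1) (hsq : ∑ a, p a ^ 2 < 1)
    {s : ℂ} (hs : ∑ a, (p a : ℂ) ^ s = 1) (hs_re : |s.re - 1| ≤ 1 / 2) (hs_im : 1 ≤ s.im)
    {c x η B : ℝ} (hx : 1 ≤ x) (hpx : ∀ a, 1 ≤ p a * x) (hs_η : |s.re - 1| ≤ η)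
    (hB : ∀ a, ∀ t ∈ Set.Icc (p a * x) x, |meanSize p t / t - c| ≤ B) :
    Real.exp (-(4 * s.im)) ≤ (∑ a, (p a)⁻¹) * (x ^ η * B) + 2 * x ^ (-(1 / 2) : ℝ) := by
  obtain ⟨h_ge, h_le⟩ := abs_le.1 hs_re
  have hs_one : s ≠ 1 := by
    rintro rfl
    norm_num at hs_im
  have h_upper := norm_integral_poissonTail_le hp hsum hsq (by linarith) (by linarith) hs_one hs
    (by linarith) hpx ((abs_nonneg _).trans hs_η) (by linarith [neg_abs_le (s.re - 1)]) hB
  have h_tail := norm_Gamma_sub_integral_poissonTail_le (s := s) (by linarith) (by linarith) hx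
  have h_lower := exp_neg_le_norm_Gamma_two_sub_div (s := s) (by linarith) (by linarith) hs_im
  linarith [norm_le_norm_add_norm_sub' (Complex.Gamma (2 - s) / s)
    (∫ t in (0 : ℝ)..x, (t : ℂ) ^ (-s - 1) * poissonTail t)]

lemma rpow_div_two_le_rpow {u v θ : ℝ} (hu : 0 ≤ u) (huv : u / 2 ≤ v) (hθ₀ : 0 ≤ θ) (hθ₁ : θ ≤ 1) :
    u ^ θ / 2 ≤ v ^ θ := by
  have h_half : (2 : ℝ) ^ θ ≤ 2 :=
    (Real.rpow_le_rpow_of_exponent_le one_le_two hθ₁).trans_eq (Real.rpow_one 2)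
  calc u ^ θ / 2 ≤ u ^ θ / 2 ^ θ := by gcongr
    _ = (u / 2) ^ θ := (Real.div_rpow hu zero_le_two θ).symm
    _ ≤ v ^ θ := by gcongr

lemma exp_rpow_rpow_mul_rpow_neg {y β C : ℝ} (hy : 0 < y) :
    Real.exp (y ^ (1 + β)) ^ (C * y ^ (-β)) = Real.exp (C * y) := by
  rw [← Real.exp_mul, mul_left_comm, ← Real.rpow_add hy, add_neg_cancel_right, Real.rpow_one]

lemma false_of_exp_neg_le {D y : ℝ} (hy : 2 + D ≤ y)
    (h : Real.exp (-(4 * y)) ≤ (2 + D) * Real.exp (-(5 * y))) : False := by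
  rw [show -(4 * y) = y + -(5 * y) by ring, Real.exp_add,
    mul_le_mul_iff_left₀ (Real.exp_pos _)] at h
  linarith [Real.add_one_le_exp y]

-- With `x = exp (y ^ (1 + β))` the factor `x ^ (C y⁻ᵝ)` is `exp (C y)`, while `x ^ (-1 / 2)` is
-- much smaller than `exp (-4 y)`.
lemma exists_exp_neg_log_rpow_lt_abs {R : ℝ → ℝ} {C D q β : ℝ} (hC : 0 ≤ C) (hD : 0 ≤ D)
    (hq : 0 < q) (hβ : 0 < β)
    (hR : ∀ Y, ∃ y, Y ≤ y ∧ ∀ x B, 1 ≤ x → 1 ≤ q * x → (∀ t ∈ Set.Icc (q * x) x, |R t| ≤ B) →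
      Real.exp (-(4 * y)) ≤ D * (x ^ (C * y ^ (-β)) * B) + 2 * x ^ (-(1 / 2) : ℝ)) :
    ∃ K : ℝ, ∀ t₀ : ℝ, ∃ t : ℝ, t₀ < t ∧ Real.exp (-K * Real.log t ^ (1 / (1 + β))) < |R t| := by
  refine ⟨2 * (C + 5), ?_⟩
  by_contra! ⟨t₀, ht₀⟩
  obtain ⟨Y, hY⟩ := eventually_atTop.1 ((((tendsto_rpow_atTop hβ).eventually_ge_atTop 10).and
    (eventually_ge_atTop (2 + D))).and
    ((eventually_ge_atTop (-2 * Real.log q)).and (eventually_ge_atTop (2 * t₀))))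
  obtain ⟨y, hYy, hy⟩ := hR Y
  obtain ⟨⟨hy_ten, hy_D⟩, hy_q, hy_t₀⟩ := hY y hYy
  have hy₀ : 0 < y := by linarith
  set u := y ^ (1 + β) with hu
  have hu_ge : 10 * y ≤ u := by
    rw [hu, Real.rpow_add hy₀, Real.rpow_one, mul_comm]
    gcongr
  have hu_rpow : u ^ (1 / (1 + β)) = y := by
    rw [hu, one_div, Real.rpow_rpow_inv hy₀.le (by positivity)]
  have h_log : u / 2 ≤ Real.log (q * Real.exp u) := by
    rw [Real.log_mul hq.ne' (Real.exp_pos u).ne', Real.log_exp]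
    linarith
  have hqx : Real.exp (u / 2) ≤ q * Real.exp u := (Real.le_log_iff_exp_le (by positivity)).1 h_log
  have hqx_gt : u / 2 < q * Real.exp u := by linarith [Real.add_one_le_exp (u / 2)]
  have h_abs_le (t : ℝ) (ht : t ∈ Set.Icc (q * Real.exp u) (Real.exp u)) :
      |R t| ≤ Real.exp (-(C + 5) * y) := by
    refine (ht₀ t (by linarith [ht.1])).trans (Real.exp_le_exp.2 ?_)
    have h := rpow_div_two_le_rpow (θ := 1 / (1 + β)) (by linarith)
      (h_log.trans (Real.log_le_log (by positivity) ht.1)) (by positivity)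
      (div_le_one_of_le₀ (by linarith) (by positivity))
    rw [hu_rpow] at h
    nlinarith
  have h_le := hy _ _ (Real.one_le_exp (by linarith)) (by linarith) h_abs_le
  refine false_of_exp_neg_le hy_D (h_le.trans ?_)
  have h_half : Real.exp u ^ (-(1 / 2) : ℝ) ≤ Real.exp (-(5 * y)) := by
    rw [← Real.exp_mul]
    exact Real.exp_le_exp.2 (by linarith)
  rw [exp_rpow_rpow_mul_rpow_neg hy₀, ← Real.exp_add,
    show C * y + -(C + 5) * y = -(5 * y) by ring]
  linarith

theorem exists_lt_abs_meanSize_div_sub [Nontrivial A] (hp : ∀ a, 0 < p a) (hsum : ∑ a, p a = 1)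
    (hd : period p = 0) (c : ℝ) :
    ∃ K : ℝ, ∀ t₀ : ℝ, ∃ t : ℝ, t₀ < t ∧
      Real.exp (-K * Real.log t ^ (((Fintype.card A : ℝ) - 1) / ((Fintype.card A : ℝ) + 1))) <
        |meanSize p t / t - c| := by
  obtain ⟨C, hC, h_root⟩ := exists_root_near_line hp hsum hd
  obtain ⟨b, hb⟩ := Finite.exists_min p
  have hn : 0 < (Fintype.card A : ℝ) - 1 := sub_pos.2 (by exact_mod_cast Fintype.one_lt_card)
  have h_exponent : ((Fintype.card A : ℝ) - 1) / ((Fintype.card A : ℝ) + 1) =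
      1 / (1 + 2 / ((Fintype.card A : ℝ) - 1)) := by
    field_simp
    ring
  rw [h_exponent]
  refine exists_exp_neg_log_rpow_lt_abs (D := ∑ a, (p a)⁻¹) hC.le
    (Finset.sum_nonneg fun a _ => (inv_pos.2 (hp a)).le) (hp b) (by positivity) fun Y => ?_
  obtain ⟨s, hs, hs_im, hs_re, hs_near⟩ := h_root (max Y 1)
  refine ⟨s.im, (le_max_left _ _).trans hs_im, fun x B hx hbx hB => ?_⟩
  have h_mul_le (a : A) : p b * x ≤ p a * x := by gcongr; exact hb a
  exact exp_neg_le_of_root hp hsum (sum_sq_lt_one hp hsum) hs hs_re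
    ((le_max_right _ _).trans hs_im) hx (fun a => hbx.trans (h_mul_le a)) hs_near
    fun a t ht => hB t ⟨(h_mul_le a).trans ht.1, ht.2⟩

end LowerBound

lemma rpow_neg_isLittleO_exp_neg_log_rpow (K : ℝ) {θ ε : ℝ} (hθ : θ < 1) (hε : 0 < ε) :
    (fun t : ℝ => t ^ (-ε)) =o[atTop] fun t => Real.exp (-K * Real.log t ^ θ) := by
  have h_exp : (fun u : ℝ => Real.exp (-ε * u)) =o[atTop] fun u => Real.exp (-K * u ^ θ) := by
    rw [Real.isLittleO_exp_comp_exp_comp]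
    have h_lim : Tendsto (fun u : ℝ => ε - K * u ^ (θ - 1)) atTop (𝓝 (ε - K * 0)) := by
      have h := tendsto_rpow_neg_atTop (sub_pos.2 hθ)
      rw [neg_sub] at h
      exact (h.const_mul K).const_sub ε
    rw [mul_zero, sub_zero] at h_lim
    refine (h_lim.pos_mul_atTop hε tendsto_id).congr' ?_
    filter_upwards [eventually_gt_atTop 0] with u hu
    rw [Real.rpow_sub_one hu.ne', id]
    field_simp
    ring
  refine (h_exp.comp_tendsto Real.tendsto_log_atTop).congr' ?_ .rfl
  filter_upwards [eventually_gt_atTop 0] with t ht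
  rw [Function.comp_apply, Real.rpow_def_of_pos ht, mul_comm]

lemma not_isBigO_rpow_neg {R : ℝ → ℝ} {K θ : ℝ} (hθ : θ < 1)
    (hR : ∀ t₀ : ℝ, ∃ t : ℝ, t₀ < t ∧ Real.exp (-K * Real.log t ^ θ) < |R t|) {ε : ℝ}
    (hε : 0 < ε) : ¬ R =O[atTop] fun t : ℝ => t ^ (-ε) := by
  intro hO
  have ho := hO.trans_isLittleO (rpow_neg_isLittleO_exp_neg_log_rpow K hθ hε)
  obtain ⟨t₀, ht₀⟩ := eventually_atTop.1 (ho.bound one_pos)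
  obtain ⟨t, ht, h_lt⟩ := hR t₀
  have h_le := ht₀ t ht.le
  rw [one_mul, Real.norm_eq_abs, Real.norm_of_nonneg (Real.exp_pos _).le] at h_le
  exact h_lt.not_ge h_le

section Thinning

open unitInterval

variable {Ω : Type*} [MeasurableSpace Ω] {μ : Measure Ω}

lemma hasLaw_mem_of_measureReal_eq [IsProbabilityMeasure μ] {E : Set Ω} (hE : MeasurableSet E)
    {q : I} (hq : μ.real E = q) :
    HasLaw (· ∈ E) (toNNReal q • Measure.dirac True + toNNReal (σ q) • Measure.dirac False) μ where
  aemeasurable := (measurable_mem.2 hE).aemeasurable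
  map_eq := by
    have hE_compl : μ.real Eᶜ = σ q := by rw [probReal_compl_eq_one_sub hE, hq, coe_symm_eq]
    have h_ofReal (u : I) : ENNReal.ofReal u = toNNReal u := ENNReal.ofReal_eq_coe_nnreal u.2.1
    refine Measure.ext_of_singleton fun P => ?_
    rw [Measure.map_apply (measurable_mem.2 hE) (measurableSet_singleton P)]
    by_cases hP : P
    · have h_set : (· ∈ E) ⁻¹' {P} = E := by ext ω; simp [hP]
      rw [h_set, ← ofReal_measureReal, hq, h_ofReal]
      simp [hP]
    · have h_set : (· ∈ E) ⁻¹' {P} = Eᶜ := by ext ω; simp [hP]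
      rw [h_set, ← ofReal_measureReal, hE_compl, h_ofReal]
      simp [hP]

lemma isSetBernoulli_of_iIndepSet {ι : Type*} [Countable ι] {E : ι → Set Ω}
    (hE : ∀ k, MeasurableSet (E k))
    (hind : iIndepSet E μ) {q : I} (hq : ∀ k, μ.real (E k) = q) (u : Set ι) :
    IsSetBernoulli (fun ω => {k | k ∈ u ∧ ω ∈ E k}) u q μ := by
  have := hind.isProbabilityMeasure
  have h_indep : iIndepFun (fun k ω => k ∈ u ∧ ω ∈ E k) μ := by
    have h_mem : iIndepFun (fun k ω => ω ∈ E k) μ := by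
      rw [iIndepFun_iff_iIndep]
      simpa only [iIndepSet_iff_iIndep, MeasurableSpace.generateFrom_singleton] using! hind
    exact h_mem.comp (fun k P => k ∈ u ∧ P) fun _ => .of_discrete
  have h_law (k : ι) : HasLaw (fun ω => k ∈ u ∧ ω ∈ E k)
      (toNNReal q • Measure.dirac (k ∈ u) + toNNReal (σ q) • Measure.dirac False) μ := by
    have h_and : Measurable fun P => k ∈ u ∧ P := .of_discrete
    refine HasLaw.fun_comp ⟨h_and.aemeasurable, ?_⟩ (hasLaw_mem_of_measureReal_eq (hE k) (hq k))
    rw [Measure.map_add _ _ h_and]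
    simp [Measure.map_smul, Measure.map_dirac]
  refine HasLaw.fun_comp (Y := fun s => {k | s k})
    ⟨?_, (setBernoulli_eq_map u q).symm⟩ (h_indep.hasLaw_infinitePi h_law ?_)
  · exact MeasurableEquiv.setOfPred.measurable.aemeasurable
  · exact aemeasurable_pi_lambda _ fun k => (h_law k).aemeasurable

lemma hasLaw_ncard_of_iIndepSet {E : ℕ → Set Ω} (hE : ∀ k, MeasurableSet (E k))
    (hind : iIndepSet E μ) {q : I} (hq : ∀ k, μ.real (E k) = q) (n : ℕ) :
    HasLaw (fun ω => Set.ncard {k | k < n ∧ ω ∈ E k}) (binomial n q) μ :=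
  HasLaw.fun_comp ⟨by fun_prop, rfl⟩ (isSetBernoulli_of_iIndepSet hE hind hq (Set.Iio n))

lemma poissonMeasure_mul_binomial (r : NNReal) (q : I) (m k : ℕ) :
    poissonMeasure r {m + k} * binomial (m + k) q {k} =
      poissonMeasure (r * toNNReal q) {k} * poissonMeasure (r * toNNReal (σ q)) {m} := by
  simp_rw [poissonMeasure_singleton, binomial_singleton]
  rw [← ENNReal.ofReal_mul (by positivity), ← ENNReal.ofReal_mul (by positivity)]
  congr 1
  have h_exp : Real.exp (-r) = Real.exp (-(r * q)) * Real.exp (-(r * (1 - q))) := by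
    rw [← Real.exp_add]
    ring_nf
  rw [Nat.add_sub_cancel, add_comm m k, Nat.cast_add_choose ℝ, h_exp, NNReal.coe_mul,
    NNReal.coe_mul, coe_toNNReal, coe_toNNReal, coe_symm_eq, mul_pow, mul_pow]
  field_simp
  ring

lemma tsum_poissonMeasure_mul_binomial (r : NNReal) (q : I) (k : ℕ) :
    ∑' n, poissonMeasure r {n} * binomial n q {k} = poissonMeasure (r * toNNReal q) {k} := by
  have h_zero (n : ℕ) (hn : n ∈ Finset.range k) :
      poissonMeasure r {n} * binomial n q {k} = 0 := by
    rw [binomial_singleton, Nat.choose_eq_zero_of_lt (Finset.mem_range.1 hn)]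
    simp
  have h_total : ∑' m, poissonMeasure (r * toNNReal (σ q)) {m} = 1 := by
    simpa using Measure.tsum_indicator_apply_singleton (poissonMeasure _) Set.univ .univ
  rw [← ENNReal.summable.sum_add_tsum_nat_add' (k := k), Finset.sum_eq_zero h_zero, zero_add,
    tsum_congr fun m => poissonMeasure_mul_binomial r q m k, ENNReal.tsum_mul_left, h_total,
    mul_one]

lemma hasLaw_poissonMeasure_mul {𝓧 : Type*} [MeasurableSpace 𝓧] {N : Ω → ℕ} {X : Ω → 𝓧}
    {M : ℕ → 𝓧 → ℕ} {r : NNReal} {q : I} (hN : HasLaw N (poissonMeasure r) μ)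
    (hX : AEMeasurable X μ) (hM : ∀ n, Measurable (M n)) (hNX : IndepFun N X μ)
    (hMX : ∀ n, HasLaw (fun ω => M n (X ω)) (binomial n q) μ) :
    HasLaw (fun ω => M (N ω) (X ω)) (poissonMeasure (r * toNNReal q)) μ := by
  have hM_meas : Measurable fun z : ℕ × 𝓧 => M z.1 z.2 := measurable_from_prod_countable_right hM
  have := hN.isProbabilityMeasure
  have hNX_meas := hN.aemeasurable.prodMk hX
  refine ⟨hM_meas.comp_aemeasurable hNX_meas, Measure.ext_of_singleton fun k => ?_⟩
  have h_slice (n : ℕ) : μ.map X (M n ⁻¹' {k}) = binomial n q {k} := by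
    rw [Measure.map_apply_of_aemeasurable hX (hM n (measurableSet_singleton k))]
    exact (hMX n).measure_eq (measurableSet_singleton k)
  calc μ.map (fun ω => M (N ω) (X ω)) {k}
      = ((poissonMeasure r).prod (μ.map X)) ((fun z => M z.1 z.2) ⁻¹' {k}) := by
        rw [← hN.map_eq, ← (indepFun_iff_map_prod_eq_prod_map_map hN.aemeasurable hX).1 hNX,
          ← Measure.map_apply hM_meas (measurableSet_singleton k),
          AEMeasurable.map_map_of_aemeasurable hM_meas.aemeasurable hNX_meas]
        rfl
    _ = ∑' n, poissonMeasure r {n} * binomial n q {k} := by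
        rw [Measure.prod_apply (hM_meas (measurableSet_singleton k)), lintegral_countable']
        simp_rw [← h_slice, mul_comm]
        rfl
    _ = poissonMeasure (r * toNNReal q) {k} := tsum_poissonMeasure_mul_binomial r q k

end Thinning

section Tries

variable {A : Type*}

lemma finite_setOf_lt_and_isPrefixOf (x : ℕ → ℕ → A) (n : ℕ) (v : List A) :
    {k | k < n ∧ IsPrefixOf v (x k)}.Finite :=
  (Set.finite_lt_nat n).subset fun _ hk => hk.1

lemma IsPrefixOf.of_append {v w : List A} {x : ℕ → A} (h : IsPrefixOf (v ++ w) x) :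
    IsPrefixOf v x := by
  intro i hi
  rw [← h i (by rw [List.length_append]; omega), List.getElem_append_left hi]

lemma IsPrefixOf.append_singleton {v : List A} {x : ℕ → A} (h : IsPrefixOf v x) :
    IsPrefixOf (v ++ [x v.length]) x := by
  intro i hi
  rw [List.length_append, List.length_singleton] at hi
  rcases Nat.lt_or_ge i v.length with h_lt | h_ge
  · rw [List.getElem_append_left h_lt, h i h_lt]
  · obtain rfl : i = v.length := by omega
    simp

lemma prefixCount_append_le (x : ℕ → ℕ → A) (n : ℕ) (v w : List A) :
    prefixCount x n (v ++ w) ≤ prefixCount x n v :=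
  Set.ncard_le_ncard (fun _ hk => ⟨hk.1, hk.2.of_append⟩) (finite_setOf_lt_and_isPrefixOf x n v)

lemma mem_internalNodes_trie {x : ℕ → ℕ → A} {n : ℕ} {v : List A} :
    v ∈ internalNodes (trie x n) ↔ 2 ≤ prefixCount x n v := by
  constructor
  · rintro ⟨-, a, h_two | ⟨-, h_root | h_parent⟩⟩
    · exact h_two.trans (prefixCount_append_le x n v [a])
    · simp at h_root
    · rwa [List.dropLast_concat] at h_parent
  · intro h_two
    obtain ⟨k, hk_lt, hk_prefix⟩ : {k | k < n ∧ IsPrefixOf v (x k)}.Nonempty :=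
      (Set.ncard_pos (finite_setOf_lt_and_isPrefixOf x n v)).1 (two_pos.trans_le h_two)
    have h_child : 0 < prefixCount x n (v ++ [x k v.length]) :=
      (Set.ncard_pos (finite_setOf_lt_and_isPrefixOf x n _)).2
        ⟨k, hk_lt, hk_prefix.append_singleton⟩
    refine ⟨Or.inl h_two, x k v.length, ?_⟩
    rcases Nat.lt_or_ge 1 (prefixCount x n (v ++ [x k v.length])) with h_many | h_one
    · exact Or.inl h_many
    · exact Or.inr ⟨by omega, Or.inr (by rwa [List.dropLast_concat])⟩

lemma internalNodes_trie (x : ℕ → ℕ → A) (n : ℕ) :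
    internalNodes (trie x n) = {v | 2 ≤ prefixCount x n v} :=
  Set.ext fun _ => mem_internalNodes_trie

lemma size_eq_toReal_encard (T : Set (List A)) :
    (size T : ℝ) = ((internalNodes T).encard : ENNReal).toReal := by
  rw [size, Set.ncard]
  cases (internalNodes T).encard <;> simp

lemma encard_internalNodes_randomTrie {Ω : Type*} (ξ : ℕ → ℕ → Ω → A) (N : Ω → ℕ) (ω : Ω) :
    ((internalNodes (randomTrie ξ N ω)).encard : ENNReal) = ∑' v : List A,
      {ω | 2 ≤ prefixCount (fun k i => ξ k i ω) (N ω) v}.indicator (fun _ => 1) ω := by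
  rw [randomTrie, internalNodes_trie, ← ENNReal.tsum_set_one,
    tsum_subtype _ fun _ => (1 : ENNReal)]
  rfl

lemma finite_trie_of_finite_internalNodes [Finite A] {x : ℕ → ℕ → A} {n : ℕ}
    (h : (internalNodes (trie x n)).Finite) : (trie x n).Finite := by
  rw [internalNodes_trie] at h
  refine ((h.union (Set.finite_singleton [])).union
    (h.image2 (fun v a => v ++ [a]) Set.finite_univ)).subset ?_
  rintro v (h_two | ⟨-, rfl | h_parent⟩)
  · exact Or.inl (Or.inl h_two)
  · exact Or.inl (Or.inr rfl)
  · rcases List.eq_nil_or_concat' v with rfl | ⟨w, a, rfl⟩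
    · exact Or.inl (Or.inr rfl)
    · rw [List.dropLast_concat] at h_parent
      exact Or.inr ⟨w, h_parent, a, Set.mem_univ a, rfl⟩

lemma chi_eq_zero (A : Type*) : chi A = 0 := by
  have h_root : ([] : List A) ∉ internalNodes (rootTree A) := by
    rintro ⟨-, a, h⟩
    simp [rootTree] at h
  rw [chi, sizeToll, if_neg h_root]

variable [MeasurableSpace A] [MeasurableSingletonClass A]

lemma measurableSet_isPrefixOf (v : List A) : MeasurableSet {x : ℕ → A | IsPrefixOf v x} := by
  have h_letters : {x : ℕ → A | IsPrefixOf v x} =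
      ⋂ (i : ℕ) (hi : i < v.length), (fun x => x i) ⁻¹' {v[i]} := by
    ext x
    simp [IsPrefixOf, eq_comm]
  rw [h_letters]
  exact .iInter fun i => .iInter fun _ => measurable_pi_apply i (measurableSet_singleton _)

lemma measurable_prefixCount (n : ℕ) (v : List A) :
    Measurable fun x : ℕ → ℕ → A => prefixCount x n v := by
  have h_set : Measurable fun x : ℕ → ℕ → A => {k | k < n ∧ IsPrefixOf v (x k)} :=
    measurable_set_iff.2 fun k => measurable_const.and
      ((measurable_mem.2 (measurableSet_isPrefixOf v)).comp (measurable_pi_apply k))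
  exact (by fun_prop : Measurable (Set.ncard : Set ℕ → ℕ)).comp h_set

end Tries

section RandomTries

open unitInterval

/-- The letters `ξ k i` (the `i`-th letter of the `k`-th string) are independent, with common
distribution `p`. -/
structure IsMemorylessSource {A Ω : Type*} [MeasurableSpace A] [MeasurableSpace Ω] (p : A → ℝ)
    (ξ : ℕ → ℕ → Ω → A) (μ : Measure Ω) : Prop where
  measurable : ∀ k i, Measurable (ξ k i)
  measureReal_eq : ∀ k i a, μ.real {ω | ξ k i ω = a} = p a
  iIndepFun : iIndepFun (fun ki : ℕ × ℕ => ξ ki.1 ki.2) μ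

variable {A Ω : Type*} [MeasurableSpace A] [MeasurableSpace Ω] {p : A → ℝ} {μ : Measure Ω}
  {ξ : ℕ → ℕ → Ω → A}

lemma IsMemorylessSource.measurable_strings (hξ : IsMemorylessSource p ξ μ) :
    Measurable fun ω k i => ξ k i ω :=
  measurable_pi_lambda _ fun k => measurable_pi_lambda _ fun i => hξ.measurable k i

lemma IsMemorylessSource.nonneg (hξ : IsMemorylessSource p ξ μ) (a : A) : 0 ≤ p a :=
  hξ.measureReal_eq 0 0 a ▸ measureReal_nonneg

lemma IsMemorylessSource.measureReal_biInter_isPrefixOf [MeasurableSingletonClass A]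
    (hξ : IsMemorylessSource p ξ μ) (v : List A) (S : Finset ℕ) :
    μ.real (⋂ k ∈ S, {ω | IsPrefixOf v fun i => ξ k i ω}) = ∏ _k ∈ S, stringProb p v := by
  set B : ℕ × ℕ → Set A := fun ki => {a | ∀ h : ki.2 < v.length, v[ki.2] = a} with hB
  have h_letters : (⋂ k ∈ S, {ω | IsPrefixOf v fun i => ξ k i ω}) =
      ⋂ ki ∈ S ×ˢ Finset.range v.length, ξ ki.1 ki.2 ⁻¹' B ki := by
    ext ω
    simp only [Set.mem_iInter, Finset.mem_product, Finset.mem_range, Prod.forall, hB,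
      Set.mem_preimage, Set.mem_ofPred_eq, IsPrefixOf]
    exact ⟨fun h k i hki _ => h k hki.1 i hki.2, fun h k hk i hi => h k i ⟨hk, hi⟩ hi⟩
  have hB_eq (k : ℕ) (i : Fin v.length) : B (k, i) = {v[i]} := by
    ext a
    simp [hB, eq_comm]
  have hB_meas (ki : ℕ × ℕ) (hki : ki ∈ S ×ˢ Finset.range v.length) : MeasurableSet (B ki) := by
    rw [hB_eq ki.1 ⟨ki.2, Finset.mem_range.1 (Finset.mem_product.1 hki).2⟩]
    exact measurableSet_singleton _
  rw [measureReal_def, h_letters, hξ.iIndepFun.measure_inter_preimage_eq_mul _ hB_meas,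
    Finset.prod_product, ENNReal.toReal_prod]
  refine Finset.prod_congr rfl fun k _ => ?_
  rw [Finset.prod_range, ENNReal.toReal_prod, stringProb, ← Fin.prod_univ_fun_getElem]
  refine Finset.prod_congr rfl fun i _ => ?_
  rw [hB_eq]
  exact hξ.measureReal_eq k i v[i]

lemma IsMemorylessSource.measureReal_isPrefixOf [MeasurableSingletonClass A]
    (hξ : IsMemorylessSource p ξ μ) (v : List A) (k : ℕ) :
    μ.real {ω | IsPrefixOf v fun i => ξ k i ω} = stringProb p v := by
  simpa using hξ.measureReal_biInter_isPrefixOf v {k}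

lemma IsMemorylessSource.measurableSet_isPrefixOf [MeasurableSingletonClass A]
    (hξ : IsMemorylessSource p ξ μ) (v : List A) (k : ℕ) :
    MeasurableSet {ω | IsPrefixOf v fun i => ξ k i ω} :=
  (measurable_pi_lambda _ fun i => hξ.measurable k i) (RandomTrie.measurableSet_isPrefixOf v)

lemma IsMemorylessSource.iIndepSet_isPrefixOf [MeasurableSingletonClass A]
    (hξ : IsMemorylessSource p ξ μ) (v : List A) :
    iIndepSet (fun k => {ω | IsPrefixOf v fun i => ξ k i ω}) μ := by
  have := hξ.iIndepFun.isProbabilityMeasure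
  refine (iIndepSet_iff_meas_biInter (hξ.measurableSet_isPrefixOf v)).2 fun S => ?_
  rw [← ofReal_measureReal, hξ.measureReal_biInter_isPrefixOf,
    ENNReal.ofReal_prod_of_nonneg fun _ _ => stringProb_nonneg hξ.nonneg v]
  exact Finset.prod_congr rfl fun k _ => by rw [← hξ.measureReal_isPrefixOf v k, ofReal_measureReal]

variable {N : Ω → ℕ}

lemma IsMemorylessSource.hasLaw_prefixCount [MeasurableSingletonClass A]
    (hξ : IsMemorylessSource p ξ μ) {r : NNReal} (hN : HasLaw N (poissonMeasure r) μ)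
    (hNξ : IndepFun N (fun ω k i => ξ k i ω) μ) (v : List A) :
    HasLaw (fun ω => prefixCount (fun k i => ξ k i ω) (N ω) v)
      (poissonMeasure (r * (stringProb p v).toNNReal)) μ := by
  have := hξ.iIndepFun.isProbabilityMeasure
  obtain ⟨q, hq⟩ : ∃ q : I, stringProb p v = q :=
    ⟨⟨_, stringProb_nonneg hξ.nonneg v, hξ.measureReal_isPrefixOf v 0 ▸ measureReal_le_one⟩, rfl⟩
  rw [hq, ← coe_toNNReal, Real.toNNReal_coe]
  exact hasLaw_poissonMeasure_mul (M := fun n x => prefixCount x n v) hN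
    hξ.measurable_strings.aemeasurable (fun n => measurable_prefixCount n v) hNξ
    (hasLaw_ncard_of_iIndepSet (hξ.measurableSet_isPrefixOf v) (hξ.iIndepSet_isPrefixOf v)
      fun k => (hξ.measureReal_isPrefixOf v k).trans hq)

lemma poissonMeasure_real_Ici_two (r : NNReal) :
    (poissonMeasure r).real (Set.Ici 2) = poissonTail r := by
  have h_compl : (Set.Ici 2)ᶜ = ({0, 1} : Set ℕ) := by
    ext k
    simp only [Set.mem_compl_iff, Set.mem_Ici, Set.mem_insert_iff, Set.mem_singleton_iff]
    omega
  have h_pair : (poissonMeasure r).real {0, 1} = (1 + r) * Real.exp (-r) := by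
    rw [Set.insert_eq, measureReal_union (by simp) (measurableSet_singleton 1),
      poissonMeasure_real_singleton, poissonMeasure_real_singleton]
    simp
    ring
  rw [← compl_compl (Set.Ici 2), h_compl, probReal_compl_eq_one_sub (Set.toFinite _).measurableSet,
    h_pair, poissonTail]

lemma IsMemorylessSource.measure_two_le_prefixCount [MeasurableSingletonClass A]
    (hξ : IsMemorylessSource p ξ μ) {r : NNReal} (hN : HasLaw N (poissonMeasure r) μ)
    (hNξ : IndepFun N (fun ω k i => ξ k i ω) μ) (v : List A) :
    μ {ω | 2 ≤ prefixCount (fun k i => ξ k i ω) (N ω) v} =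
      ENNReal.ofReal (poissonTail (r * stringProb p v)) := by
  rw [(hξ.hasLaw_prefixCount hN hNξ v).measure_eq measurableSet_Ici, ← ofReal_measureReal]
  have h := poissonMeasure_real_Ici_two (r * (stringProb p v).toNNReal)
  rw [NNReal.coe_mul, Real.coe_toNNReal _ (stringProb_nonneg hξ.nonneg v)] at h
  exact congrArg ENNReal.ofReal h

lemma IsMemorylessSource.nullMeasurableSet_two_le_prefixCount [MeasurableSingletonClass A]
    (hξ : IsMemorylessSource p ξ μ) {r : NNReal} (hN : HasLaw N (poissonMeasure r) μ)
    (hNξ : IndepFun N (fun ω k i => ξ k i ω) μ) (v : List A) :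
    NullMeasurableSet {ω | 2 ≤ prefixCount (fun k i => ξ k i ω) (N ω) v} μ :=
  (hξ.hasLaw_prefixCount hN hNξ v).aemeasurable.nullMeasurableSet_preimage measurableSet_Ici

lemma IsMemorylessSource.aemeasurable_encard_internalNodes [Finite A] [MeasurableSingletonClass A]
    (hξ : IsMemorylessSource p ξ μ) {r : NNReal} (hN : HasLaw N (poissonMeasure r) μ)
    (hNξ : IndepFun N (fun ω k i => ξ k i ω) μ) :
    AEMeasurable (fun ω => ((internalNodes (randomTrie ξ N ω)).encard : ENNReal)) μ := by
  simp_rw [encard_internalNodes_randomTrie]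
  exact AEMeasurable.tsum fun v =>
    aemeasurable_const.indicator₀ (hξ.nullMeasurableSet_two_le_prefixCount hN hNξ v)

lemma IsMemorylessSource.lintegral_encard_internalNodes [Fintype A] [MeasurableSingletonClass A]
    (hξ : IsMemorylessSource p ξ μ) (hsq : ∑ a, p a ^ 2 < 1) {r : NNReal}
    (hN : HasLaw N (poissonMeasure r) μ) (hNξ : IndepFun N (fun ω k i => ξ k i ω) μ) :
    ∫⁻ ω, (internalNodes (randomTrie ξ N ω)).encard ∂μ = ENNReal.ofReal (meanSize p r) := by
  have h_meas := hξ.nullMeasurableSet_two_le_prefixCount hN hNξ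
  simp_rw [encard_internalNodes_randomTrie]
  rw [lintegral_tsum fun v => aemeasurable_const.indicator₀ (h_meas v)]
  simp_rw [lintegral_indicator_const₀ (h_meas _), one_mul, hξ.measure_two_le_prefixCount hN hNξ]
  exact (ENNReal.ofReal_tsum_of_nonneg
    (fun v => poissonTail_nonneg (mul_nonneg r.coe_nonneg (stringProb_nonneg hξ.nonneg v)))
    (summable_poissonTail hξ.nonneg hsq r.coe_nonneg)).symm

lemma IsMemorylessSource.ae_finite_randomTrie [Fintype A] [MeasurableSingletonClass A]
    (hξ : IsMemorylessSource p ξ μ) (hsq : ∑ a, p a ^ 2 < 1) {r : NNReal}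
    (hN : HasLaw N (poissonMeasure r) μ) (hNξ : IndepFun N (fun ω k i => ξ k i ω) μ) :
    ∀ᵐ ω ∂μ, (randomTrie ξ N ω).Finite := by
  filter_upwards [ae_lt_top' (hξ.aemeasurable_encard_internalNodes hN hNξ)
    (hξ.lintegral_encard_internalNodes hsq hN hNξ ▸ ENNReal.ofReal_ne_top)] with ω hω
  have h_fin : (internalNodes (randomTrie ξ N ω)).Finite := by simpa using hω
  exact finite_trie_of_finite_internalNodes h_fin

lemma IsMemorylessSource.integrable_size [Fintype A] [MeasurableSingletonClass A]
    (hξ : IsMemorylessSource p ξ μ) (hsq : ∑ a, p a ^ 2 < 1) {r : NNReal}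
    (hN : HasLaw N (poissonMeasure r) μ) (hNξ : IndepFun N (fun ω k i => ξ k i ω) μ) :
    Integrable (fun ω => (size (randomTrie ξ N ω) : ℝ)) μ := by
  simp_rw [size_eq_toReal_encard]
  exact integrable_toReal_of_lintegral_ne_top (hξ.aemeasurable_encard_internalNodes hN hNξ)
    (hξ.lintegral_encard_internalNodes hsq hN hNξ ▸ ENNReal.ofReal_ne_top)

lemma IsMemorylessSource.integral_size [Fintype A] [MeasurableSingletonClass A]
    (hξ : IsMemorylessSource p ξ μ) (hsq : ∑ a, p a ^ 2 < 1) {r : NNReal}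
    (hN : HasLaw N (poissonMeasure r) μ) (hNξ : IndepFun N (fun ω k i => ξ k i ω) μ) :
    ∫ ω, (size (randomTrie ξ N ω) : ℝ) ∂μ = meanSize p r := by
  have h_lintegral := hξ.lintegral_encard_internalNodes hsq hN hNξ
  simp_rw [size_eq_toReal_encard]
  rw [integral_toReal (hξ.aemeasurable_encard_internalNodes hN hNξ) (ae_lt_top'
    (hξ.aemeasurable_encard_internalNodes hN hNξ) (h_lintegral ▸ ENNReal.ofReal_ne_top)),
    h_lintegral, ENNReal.toReal_ofReal (meanSize_nonneg hξ.nonneg r.coe_nonneg)]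

lemma IsMemorylessSource.tollMean_eq_poissonTail [MeasurableSingletonClass A]
    (hξ : IsMemorylessSource p ξ μ) {N : ℝ → Ω → ℕ} {t : ℝ} (ht : 0 ≤ t)
    (hN : HasLaw (N t) (poissonMeasure t.toNNReal) μ)
    (hNξ : IndepFun (N t) (fun ω k i => ξ k i ω) μ) : tollMean μ ξ N t = poissonTail t := by
  have h_toll : (fun ω => sizeToll (randomTrie ξ (N t) ω)) =
      {ω | 2 ≤ prefixCount (fun k i => ξ k i ω) (N t ω) []}.indicator fun _ => 1 := by
    ext ω
    simp only [sizeToll, randomTrie, mem_internalNodes_trie, Set.indicator_apply,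
      Set.mem_ofPred_eq]
  rw [tollMean, chi_eq_zero, zero_mul, zero_mul, sub_zero, h_toll,
    integral_indicator₀ (hξ.nullMeasurableSet_two_le_prefixCount hN hNξ []), setIntegral_const,
    measureReal_def, hξ.measure_two_le_prefixCount hN hNξ, stringProb_nil, mul_one,
    Real.coe_toNNReal t ht, ENNReal.toReal_ofReal (poissonTail_nonneg ht), smul_eq_mul, mul_one]

end RandomTries

lemma hasMellin_congr_of_eqOn {E : Type*} [NormedAddCommGroup E] [NormedSpace ℂ E] {f g : ℝ → E}
    {s : ℂ} {m : E} (hf : HasMellin f s m) (hfg : Set.EqOn f g (Set.Ioi 0)) : HasMellin g s m := by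
  have h_eqOn : Set.EqOn (fun t : ℝ => (t : ℂ) ^ (s - 1) • f t) (fun t => (t : ℂ) ^ (s - 1) • g t)
      (Set.Ioi 0) := fun t ht => congrArg ((t : ℂ) ^ (s - 1) • ·) (hfg ht)
  exact ⟨hf.1.congr_fun h_eqOn measurableSet_Ioi,
    (setIntegral_congr_fun measurableSet_Ioi h_eqOn).symm.trans hf.2⟩

end RandomTrie

theorem mainTheorem12
    {A : Type*} [Fintype A] [Nontrivial A] [MeasurableSpace A] [MeasurableSingletonClass A]
    (p : A → ℝ) (hp_pos : ∀ a, 0 < p a) (hp_sum : ∑ a, p a = 1)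
    (hp_aperiodic : RandomTrie.period p = 0)
    {Ω : Type*} [MeasurableSpace Ω] (μ : Measure Ω) [IsProbabilityMeasure μ]
    -- the letters of the random strings are i.i.d. with distribution `p`
    (ξ : ℕ → ℕ → Ω → A)
    (hξ_meas : ∀ k i, Measurable (ξ k i))
    (hξ_law : ∀ k i a, μ.real {ω | ξ k i ω = a} = p a)
    (hξ_indep : iIndepFun (fun (ki : ℕ × ℕ) => ξ ki.1 ki.2) μ)
    -- for `t > 0`, the number `N t` of strings is `Po(t)` and independent of the strings
    (N : ℝ → Ω → ℕ)
    (hN_meas : ∀ t, 0 < t → Measurable (N t))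
    (hN_law : ∀ t, 0 < t → μ.map (N t) = poissonMeasure t.toNNReal)
    (hN_indep : ∀ t, 0 < t → IndepFun (N t) (fun ω k i => ξ k i ω) μ) :
    (∀ t, 0 < t → (∀ᵐ ω ∂μ, (RandomTrie.randomTrie ξ (N t) ω).Finite) ∧
      Integrable (fun ω => (RandomTrie.size (RandomTrie.randomTrie ξ (N t) ω) : ℝ)) μ) ∧
    RandomTrie.chi A = 0 ∧
    HasMellin (fun t : ℝ => (RandomTrie.tollMean μ ξ N t : ℂ)) (-1) 1 ∧
    ∃ R : ℝ → ℝ,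
      (∀ t, 0 < t →
        (∫ ω, (RandomTrie.size (RandomTrie.randomTrie ξ (N t) ω) : ℝ) ∂μ) / t
          = (RandomTrie.entropy p)⁻¹ + R t) ∧
      Tendsto R atTop (𝓝 0) ∧
      (∃ C : ℝ, ∀ t₀ : ℝ, ∃ t : ℝ, t₀ < t ∧
        Real.exp (-C * Real.log t ^
          (((Fintype.card A : ℝ) - 1) / ((Fintype.card A : ℝ) + 1))) < |R t|) ∧
      (∀ ε : ℝ, 0 < ε → ¬ (R =O[atTop] fun t : ℝ => t ^ (-ε))) := by
  have hξ : RandomTrie.IsMemorylessSource p ξ μ := ⟨hξ_meas, hξ_law, hξ_indep⟩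
  have hsq := RandomTrie.sum_sq_lt_one hp_pos hp_sum
  have hN (t : ℝ) (ht : 0 < t) : HasLaw (N t) (poissonMeasure t.toNNReal) μ :=
    ⟨(hN_meas t ht).aemeasurable, hN_law t ht⟩
  have h_toll : Set.EqOn (fun t => (RandomTrie.poissonTail t : ℂ))
      (fun t => (RandomTrie.tollMean μ ξ N t : ℂ)) (Set.Ioi 0) := fun t (ht : 0 < t) =>
    congrArg _ (hξ.tollMean_eq_poissonTail ht.le (hN t ht) (hN_indep t ht)).symm
  obtain ⟨C, hC⟩ := RandomTrie.exists_lt_abs_meanSize_div_sub hp_pos hp_sum hp_aperiodic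
    (RandomTrie.entropy p)⁻¹
  refine ⟨fun t ht => ⟨hξ.ae_finite_randomTrie hsq (hN t ht) (hN_indep t ht),
      hξ.integrable_size hsq (hN t ht) (hN_indep t ht)⟩, RandomTrie.chi_eq_zero A,
    RandomTrie.hasMellin_congr_of_eqOn RandomTrie.hasMellin_poissonTail_neg_one h_toll,
    fun t => RandomTrie.meanSize p t / t - (RandomTrie.entropy p)⁻¹, fun t ht => ?_, ?_,
    ⟨C, hC⟩, fun ε hε => RandomTrie.not_isBigO_rpow_neg ?_ hC hε⟩
  · rw [hξ.integral_size hsq (hN t ht) (hN_indep t ht), Real.coe_toNNReal t ht.le,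
      add_sub_cancel]
  · simpa only [sub_self] using
      (RandomTrie.tendsto_meanSize_div hp_pos hp_sum hp_aperiodic).sub_const
        (RandomTrie.entropy p)⁻¹
  · rw [div_lt_one (by positivity)]
    linarith
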